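/- Let $q^{1/2}\in\mathbb C\setminus\{0\}$ with $q\neq 1$, let $a_1,\dots,a_4,\alpha,t\in\mathbb C\setminus\{0\}$, $a_5=\alpha t$, $a_6=\alpha t^{-1}$, and let $\tilde\sigma_k$ be the $k$-th elementary symmetric function of $q^{-1/2}a_1,\dots,q^{-1/2}a_6$. Put $x=\tfrac12(z+z^{-1})$, $y_\pm=\tfrac12(q^{\pm1/2}z+q^{\mp1/2}z^{-1})$, $\Delta y=y_+-y_-$, $\Delta=(q^{1/2}-q^{-1/2})^2$, $[s]=q^s\tilde\sigma_6-q^{-s}$, $\{s\}=q^s\tilde\sigma_6+q^{-s}$. Let $W,V$ be the polynomials in $x$ with $$W\pm\Delta y\,V=z^{\mp3}\prod_{j=1}^6(1-q^{-1/2}a_jz^{\pm1}),$$ and $w_\pm=W(\pm1)$. Let $w$ be a weight that satisfies the Pearson equation $(W-\Delta y V)\,w(y_+)=(W+\Delta yV)\,w(y_-)$, of one of the following two kinds. (i) *Lattice weight.* $w$ lives on a $q$-quadratic lattice $x_s=\tfrac12(z_0q^s+z_0^{-1}q^{-s})$, $s\in\mathbb Z$, $z_0\ne0$, and may vanish outside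 a finite or half-infinite part of it; the Pearson equation holds at all midpoints $z=z_0q^{s+1/2}$; $w(x_s)\to0$ as $s\to\pm\infty$; the points with $w(x_s)\ne 0$ are bounded; and $\sum_s|\Delta y(x_s)w(x_s)|<\infty$. Put $L(\varphi)=\sum_s\Delta y(x_s)w(x_s)\varphi(x_s)$. (ii) *Interval weight.* $w$ is a weight on $(-1,1)$, regarded as a function of $z$, with $w(z^{-1})=-w(z)$; the Pearson equation holds for $|z|=1$; $w(e^{i\theta})\sin\theta$ is integrable on $(0,\pi)$; and $w(z)\cdot(W+\Delta yV)(q^{1/2}z)$ agrees, off a finite set, with a function that is continuous on the closed annulus between $|z|=1$ and $|z|=|q|^{-1/2}$ and holomorphic in its interior. Put $L(\varphi)=\int_{-1}^1w(x)\varphi(x)\,dx=\int_0^\pi w(e^{i\theta})\varphi(\cos\theta)\sin\theta\,d\theta$. Let $n\ge0$ with $[n]\neq0$, $[n+\tfrac12]\ne0$, and let $p_0,\dots,p_n$ be polynomials with $\deg p_k=k$, leading coefficients $\gamma_k$, and $L(p_jp_k)=\delta_{jk}$. Put $f(x)=L_y\big(\tfrac1{x-y}\big)$, $q_k(x)=f(x)p_k(x)-L_y\big(\tfrac{p_k(y)-p_k(x)}{y-x}\big)$,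 $a_k=\gamma_{k-1}/\gamma_k$ for $k\ge1$ (here $a_k$, $q_k$ denote the recurrence coefficient and the function of the second kind), and for $n=0$ let $a_0\ne0$ be arbitrary, $p_{-1}=0$, $q_{-1}=1/(a_0\gamma_0)$. Then there are polynomials $W_n,\Theta_n,\Omega_n$ in $x$ (the spectral coefficients) such that for all $z$ with $|z|$ sufficiently large $$\tfrac{2}{a_n}(2W_n-W)=(W+\Delta yV)[p_n(y_+)q_{n-1}(y_-)-p_{n-1}(y_+)q_n(y_-)]+(W-\Delta yV)[p_n(y_-)q_{n-1}(y_+)-p_{n-1}(y_-)q_n(y_+)],$$ $$\Delta y\,\Theta_n=(W+\Delta yV)p_n(y_+)q_n(y_-)-(W-\Delta yV)p_n(y_-)q_n(y_+),$$ $$\tfrac{2\Delta y}{a_n}(\Omega_n+V)=(W+\Delta yV)[p_n(y_+)q_{n-1}(y_-)+p_{n-1}(y_+)q_n(y_-)]-(W-\Delta yV)[p_n(y_-)q_{n-1}(y_+)+p_{n-1}(y_-)q_n(y_+)].$$ For any such polynomials, $\Theta_n$ has exactly one zero $\lambda_n$, and with $\nu_n=2W_n(\lambda_n)-W(\lambda_n)$,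 $\mu_n=\Omega_n(\lambda_n)+V(\lambda_n)$ one has the spectral conic equation $$\nu_n^2-W(\lambda_n)^2=\Delta(\lambda_n^2-1)\big[\mu_n^2-V(\lambda_n)^2\big]$$ and $$\Theta_n(x)=8\frac{[n+\frac12]}{q^{1/2}-q^{-1/2}}(x-\lambda_n).$$ If moreover $\lambda_n\ne\pm1$, then $$2W_n(x)-W(x)=\frac{x^2-1}{\lambda_n^2-1}\nu_n+(x-\lambda_n)\Big[4\{n\}(x^2-1)+\tfrac12w_+\frac{x+1}{1-\lambda_n}+\tfrac12w_-\frac{x-1}{1+\lambda_n}\Big],$$ $$\Omega_n(x)+V(x)=\mu_n+\frac{4[n]}{q^{1/2}-q^{-1/2}}x(x-\lambda_n)+\frac{16}{q^{1/2}-q^{-1/2}}\frac{\tilde\sigma_6}{[n]}\Big[\frac{\tilde\sigma_1\tilde\sigma_6+\tilde\sigma_5}{4\tilde\sigma_6}-\lambda_n\Big](x-\lambda_n)$$ $$\qquad+\frac{1}{q^{1/2}-q^{-1/2}}\frac{\{n\}}{[n]}(x-\lambda_n)\Big[\frac{\nu_n}{\lambda_n^2-1}+\tfrac12w_+\frac1{1-\lambda_n}+\tfrac12w_-\frac1{1+\lambda_n}\Big].$$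 -/

import Mathlib

open Polynomial

noncomputable section

namespace DeformedAW

/-- The parameters of the deformed Askey-Wilson system: `r` is the square root `q^{1/2}` of the
base `q`, `a` are the four fixed parameters, `α` the deformation parameter, `t` the deformation
variable (so that `u = (t + t⁻¹) / 2`). -/
structure Params where
  r : ℂ
  a : Fin 4 → ℂ
  α : ℂ
  t : ℂ

/-- The projection `x = (z + z⁻¹) / 2`. -/
def xOf (z : ℂ) : ℂ := (z + z⁻¹) / 2

namespace Params

variable (P : Params)

/-- The rescaled parameters `q^{-1/2} a_j`, `j = 1, …, 6`, where `a_5 = α t`, `a_6 = α t⁻¹`. -/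
def b : Fin 6 → ℂ :=
  ![P.r⁻¹ * P.a 0, P.r⁻¹ * P.a 1, P.r⁻¹ * P.a 2, P.r⁻¹ * P.a 3,
    P.r⁻¹ * (P.α * P.t), P.r⁻¹ * (P.α * P.t⁻¹)]

/-- The elementary symmetric functions of `q^{-1/2} a_1, …, q^{-1/2} a_6`. -/
def sig (k : ℕ) : ℂ := ∑ s ∈ Finset.powersetCard k (Finset.univ : Finset (Fin 6)), ∏ j ∈ s, P.b j

/-- `q^{1/2} - q^{-1/2}`. -/
def qd : ℂ := P.r - P.r⁻¹

/-- The node `y₊ = (q^{1/2} z + q^{-1/2} z⁻¹) / 2`. -/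
def yp (z : ℂ) : ℂ := xOf (P.r * z)

/-- The node `y₋ = (q^{-1/2} z + q^{1/2} z⁻¹) / 2`. -/
def ym (z : ℂ) : ℂ := xOf (P.r⁻¹ * z)

/-- `Δy = y₊ - y₋`. -/
def dy (z : ℂ) : ℂ := P.yp z - P.ym z

/-- The spectral data polynomial `W`. -/
def W : ℂ[X] :=
  C (4 * (1 + P.sig 6)) * X ^ 3 - C (2 * (P.sig 1 + P.sig 5)) * X ^ 2
    + C (P.sig 2 + P.sig 4 - 3 - 3 * P.sig 6) * X + C (P.sig 1 - P.sig 3 + P.sig 5)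

/-- The spectral data polynomial `V`. -/
def V : ℂ[X] :=
  C (1 / P.qd) * (C (-4 * (1 - P.sig 6)) * X ^ 2 + C (2 * (P.sig 1 - P.sig 5)) * X
    + C (1 - P.sig 2 + P.sig 4 - P.sig 6))

/-- `W + Δy V` as a function of `z`. -/
def plus (z : ℂ) : ℂ := P.W.eval (xOf z) + P.dy z * P.V.eval (xOf z)

/-- `W - Δy V` as a function of `z`. -/
def minus (z : ℂ) : ℂ := P.W.eval (xOf z) - P.dy z * P.V.eval (xOf z)

/-- `brk m` is `[m/2] = q^{m/2} σ̃₆ - q^{-m/2}`. -/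
def brk (m : ℤ) : ℂ := P.r ^ m * P.sig 6 - P.r ^ (-m)

/-- `brc m` is `{m/2} = q^{m/2} σ̃₆ + q^{-m/2}`. -/
def brc (m : ℤ) : ℂ := P.r ^ m * P.sig 6 + P.r ^ (-m)

theorem prod_one_sub (z : ℂ) :
    ∏ j, (1 - P.b j * z) = P.sig 0 - P.sig 1 * z + P.sig 2 * z ^ 2 - P.sig 3 * z ^ 3
      + P.sig 4 * z ^ 4 - P.sig 5 * z ^ 5 + P.sig 6 * z ^ 6 := by
  have h : ∀ k, (∑ s ∈ Finset.powersetCard k (Finset.univ : Finset (Fin 6)),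
      ∏ j ∈ s, (-(P.b j * z))) = (-z) ^ k * P.sig k := by
    intro k
    rw [sig, Finset.mul_sum]
    refine Finset.sum_congr rfl fun s hs => ?_
    rw [← (Finset.mem_powersetCard.1 hs).2, ← Finset.prod_const, ← Finset.prod_mul_distrib]
    exact Finset.prod_congr rfl fun j _ => by ring
  simp only [sub_eq_add_neg (1 : ℂ)]
  rw [Finset.prod_one_add, Finset.sum_powerset]
  simp only [h, Finset.card_univ, Fintype.card_fin, Finset.sum_range_succ, Finset.sum_range_zero]
  ring

theorem sig_zero : P.sig 0 = 1 := by simp [sig]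

theorem dy_eq (z : ℂ) : P.dy z = P.qd * (z - z⁻¹) / 2 := by
  simp only [dy, yp, ym, xOf, qd, mul_inv, inv_inv]
  ring

/-- The defining property of the spectral data:
`W + Δy V = z⁻³ ∏ (1 - q^{-1/2} a_j z)`. -/
theorem plus_eq (hq : P.qd ≠ 0) (z : ℂ) (hz : z ≠ 0) :
    P.plus z = (z ^ 3)⁻¹ * ∏ j, (1 - P.b j * z) := by
  rw [prod_one_sub, sig_zero, plus, dy_eq]
  simp only [W, V, xOf, eval_add, eval_sub, eval_mul, eval_C, eval_pow, eval_X]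
  field_simp
  ring

/-- The defining property of the spectral data:
`W - Δy V = z³ ∏ (1 - q^{-1/2} a_j z⁻¹)`. -/
theorem minus_eq (hq : P.qd ≠ 0) (z : ℂ) (hz : z ≠ 0) :
    P.minus z = z ^ 3 * ∏ j, (1 - P.b j * z⁻¹) := by
  rw [prod_one_sub, sig_zero, minus, dy_eq]
  simp only [W, V, xOf, eval_add, eval_sub, eval_mul, eval_C, eval_pow, eval_X]
  field_simp
  ring

end Params

/-- A weight, together with its support. Either a weight on the `q`-quadratic lattice
`x_s = (z₀ q^s + z₀⁻¹ q^{-s}) / 2`, `s ∈ ℤ`, given by its values `w s = w(x_s)` (finite and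
half-infinite lattices are those where `w` vanishes outside of `{0, …, N}` or `ℤ_{≥ 0}`);
or a weight on `(-1, 1)`, given as a function of `z`, where `x = cos θ`, `z = e^{iθ}`. -/
inductive Weight where
  | lattice (z₀ : ℂ) (w : ℤ → ℂ)
  | interval (w : ℂ → ℂ)

/-- The linear functional `φ ↦ ∫_G 𝔻x w(x) φ(x)`: the sum `∑ Δy(x_s) w(x_s) φ(x_s)` over the
lattice, or the integral of `w φ` over `(-1, 1)`, written with `x = cos θ`. -/
def Weight.integral (P : Params) : Weight → (ℂ → ℂ) → ℂ
  | .lattice z₀ w, φ =>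
      ∑' s : ℤ, P.dy (z₀ * P.r ^ (2 * s)) * w s * φ (xOf (z₀ * P.r ^ (2 * s)))
  | .interval w, φ =>
      ∫ θ in (0 : ℝ)..Real.pi,
        w (Complex.exp (θ * Complex.I)) * φ (Real.cos θ : ℂ) * (Real.sin θ : ℂ)

/-- A weight on the lattice which solves the Pearson equation
`(W - Δy V) w(y₊) = (W + Δy V) w(y₋)` at every midpoint `z = z₀ q^{s + 1/2}`, where
`y₋ = x_s`, `y₊ = x_{s+1}`. For a weight that vanishes outside of `{0, …, N}` this contains the
terminating conditions `(W + Δy V)(y₊(x_N)) = 0 = (W - Δy V)(y₋(x_0))`; on an infinite lattice the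
weight has to tend to zero at the ends. The last two conditions are for the existence of the
moments. -/
structure IsLatticeSemiClassical (P : Params) (z₀ : ℂ) (w : ℤ → ℂ) : Prop where
  ne_zero : z₀ ≠ 0
  pearson : ∀ s : ℤ, P.minus (z₀ * P.r ^ (2 * s + 1)) * w (s + 1)
    = P.plus (z₀ * P.r ^ (2 * s + 1)) * w s
  terminating : Filter.Tendsto w Filter.cofinite (nhds 0)
  bounded : ∃ B : ℝ, ∀ s : ℤ, w s ≠ 0 → ‖xOf (z₀ * P.r ^ (2 * s))‖ ≤ B
  summable : Summable fun s : ℤ => P.dy (z₀ * P.r ^ (2 * s)) * w s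

/-- A weight on `(-1, 1)` which solves the Pearson equation
`(W - Δy V) w(y₊) = (W + Δy V) w(y₋)` for `x ∈ [-1, 1]`, i.e. for `|z| = 1`. As with the
Askey-Wilson weight `(z^{±2}; q)_∞ / (sin θ ∏ (a_j z^{±1}; q)_∞)`, the product `w(x) sin θ` is
invariant under `z ↦ z⁻¹`, and the nodes `y_±` are reached from `[-1, 1]` by analytic continuation:
`w(x) (W + Δy V)(y₊)` is holomorphic between the circles `|z| = 1` and `|z| = |q|^{-1/2}` (up to
removable singularities: a pole of `w` at `z = a_j⁻¹` is cancelled by the second factor). -/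
structure IsIntervalSemiClassical (P : Params) (w : ℂ → ℂ) : Prop where
  odd : ∀ z : ℂ, w z⁻¹ = -w z
  pearson : ∀ z : ℂ, ‖z‖ = 1 → P.minus z * w (P.r * z) = P.plus z * w (P.r⁻¹ * z)
  integrable : IntervalIntegrable
    (fun θ : ℝ => w (Complex.exp (θ * Complex.I)) * (Real.sin θ : ℂ)) MeasureTheory.volume 0 Real.pi
  continuation : ∃ H : ℂ → ℂ,
    ContinuousOn H {z | min 1 ‖P.r‖⁻¹ ≤ ‖z‖ ∧ ‖z‖ ≤ max 1 ‖P.r‖⁻¹} ∧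
    DifferentiableOn ℂ H {z | min 1 ‖P.r‖⁻¹ < ‖z‖ ∧ ‖z‖ < max 1 ‖P.r‖⁻¹} ∧
    {z | (min 1 ‖P.r‖⁻¹ ≤ ‖z‖ ∧ ‖z‖ ≤ max 1 ‖P.r‖⁻¹) ∧ H z ≠ P.plus (P.r * z) * w z}.Finite

/-- The `𝔻`-semi-classical weights with the spectral data `W`, `V`. -/
def Weight.IsSemiClassical (P : Params) : Weight → Prop
  | .lattice z₀ w => IsLatticeSemiClassical P z₀ w
  | .interval w => IsIntervalSemiClassical P w

/-- `p_0, …, p_n` are orthonormal polynomials, with `deg p_k = k`, for the functional `L`. -/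
def IsOrthonormalUpTo (L : (ℂ → ℂ) → ℂ) (p : ℕ → ℂ[X]) (n : ℕ) : Prop :=
  (∀ k ≤ n, (p k).natDegree = k) ∧
  ∀ j ≤ n, ∀ k ≤ n, L (fun x => (p j).eval x * (p k).eval x) = if j = k then 1 else 0

/-- The Stieltjes function `f(x) = ∫ w(y) / (x - y)`. -/
def stieltjes (L : (ℂ → ℂ) → ℂ) (x : ℂ) : ℂ := L fun y => 1 / (x - y)

/-- For `g = p_n` the associated polynomial `p_{n-1}^{(1)}`, at a point `x` off the support. -/
def associated (L : (ℂ → ℂ) → ℂ) (g : ℂ[X]) (x : ℂ) : ℂ :=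
  L fun y => (g.eval y - g.eval x) / (y - x)

/-- For `g = p_n` the function of the second kind `q_n = f p_n - p_{n-1}^{(1)}`. -/
def secondKind (L : (ℂ → ℂ) → ℂ) (g : ℂ[X]) (x : ℂ) : ℂ :=
  stieltjes L x * g.eval x - associated L g x

/-- The recurrence coefficients `a_n = γ_{n-1} / γ_n`, with a conventional value `a_0`. -/
def recA (p : ℕ → ℂ[X]) (a₀ : ℂ) : ℕ → ℂ
  | 0 => a₀
  | k + 1 => (p k).leadingCoeff / (p (k + 1)).leadingCoeff

/-- `p_{n-1}`, where `p_{-1} = 0`. -/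
def prevP (p : ℕ → ℂ[X]) : ℕ → ℂ[X]
  | 0 => 0
  | k + 1 => p k

/-- `q_{n-1}`, where `q_{-1} = 1 / (a_0 γ_0)`. -/
def prevQ (L : (ℂ → ℂ) → ℂ) (p : ℕ → ℂ[X]) (a₀ : ℂ) : ℕ → ℂ → ℂ
  | 0, _ => 1 / (a₀ * (p 0).leadingCoeff)
  | k + 1, x => secondKind L (p k) x

/-- `Wn`, `Θn`, `Ωn` are the spectral coefficients of index `n`: polynomials that are given by the
bilinear formulae in the orthogonal polynomials and the functions of the second kind, in a
neighbourhood of `z = ∞` (on the sheet where `x → ∞` as `z → ∞`). -/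
def IsSpectralCoeffs (P : Params) (L : (ℂ → ℂ) → ℂ) (p : ℕ → ℂ[X]) (a₀ : ℂ) (n : ℕ)
    (Wn Θn Ωn : ℂ[X]) : Prop :=
  ∃ R : ℝ, ∀ z : ℂ, R < ‖z‖ →
    (2 / recA p a₀ n * (2 * Wn.eval (xOf z) - P.W.eval (xOf z))
      = P.plus z * ((p n).eval (P.yp z) * prevQ L p a₀ n (P.ym z)
          - (prevP p n).eval (P.yp z) * secondKind L (p n) (P.ym z))
        + P.minus z * ((p n).eval (P.ym z) * prevQ L p a₀ n (P.yp z)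
          - (prevP p n).eval (P.ym z) * secondKind L (p n) (P.yp z))) ∧
    (P.dy z * Θn.eval (xOf z)
      = P.plus z * (p n).eval (P.yp z) * secondKind L (p n) (P.ym z)
        - P.minus z * (p n).eval (P.ym z) * secondKind L (p n) (P.yp z)) ∧
    (2 * P.dy z / recA p a₀ n * (Ωn.eval (xOf z) + P.V.eval (xOf z))
      = P.plus z * ((p n).eval (P.yp z) * prevQ L p a₀ n (P.ym z)
          + (prevP p n).eval (P.yp z) * secondKind L (p n) (P.ym z))
        + P.minus z * (-((p n).eval (P.ym z) * prevQ L p a₀ n (P.yp z))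
          - (prevP p n).eval (P.ym z) * secondKind L (p n) (P.yp z)))

end DeformedAW

end

open Polynomial

noncomputable section

namespace DeformedAW

open Filter Topology Metric Bornology

/-! ### The spectral data at the nodes and the Cauchy kernel -/

namespace Params

variable (P : Params)

/-! The Pearson equation makes `L` annihilate the image of the Cauchy kernel under the adjoint
divided-difference operator (`IsPearsonFunctional`): by telescoping on a lattice, by moving a
contour on the interval. `Params.kernel_identity` transfers that operator from the integration
variable to the outer variable, up to a polynomial. Hence the Stieltjes function satisfies (W - Δy
V) f(y₊) - (W + Δy V) f(y₋) = Δy U with U a polynomial (`IsPearsonFunctional.exists_stieltjes_eq`).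
From here on only this equation and the boundedness of `L` matter.

Each function of the second kind is f times a polynomial minus a polynomial, so the difference
equation eliminates f from the bilinear formulae; parity in Δy then makes the coefficients
polynomials in x. Write N = 2W_n - W and M = Ω_n + V. The elimination also gives N = W + Δy² G, so
N(±1) = W(±1). Since the Casoratian is the constant 1/a_n, N² - Δy² M² = W² - Δy² V² - a_n² Δy² Θ_n
Θ', where Θ' is the analogue of Θ_n built from p_{n-1}, q_{n-1} (`Params.conic_identity`).

Orthogonality gives q_n ~ x^{-n-1}/γ_n, and growth at infinity then bounds the degrees of N, Θ_n, M
by 3, 1, 2 and yields their top coefficients (`Params.coeff_of_asymptotics`). So Θ_n is linear, and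
at its zero λ the identity becomes the conic. The cubic N is fixed by its top coefficient and its
values at 1, -1, λ; the quadratic M by its top coefficient, its value at λ, and the x⁵ coefficient
of the identity (`Params.coeff_relation`), which is solved for M using [n] ≠ 0. `spectral_conic`
assembles this. -/

theorem qd_ne_zero (hr : P.r ≠ 0) (hq : P.r ^ 2 ≠ 1) : P.qd ≠ 0 := by
  intro h
  apply hq
  have h' : P.r - P.r⁻¹ = 0 := h
  field_simp at h'
  linear_combination h'

theorem minus_inv (hqd : P.qd ≠ 0) {z : ℂ} (hz : z ≠ 0) : P.minus z⁻¹ = P.plus z := by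
  rw [P.minus_eq hqd _ (inv_ne_zero hz), P.plus_eq hqd z hz, inv_inv, inv_pow]

theorem plus_inv (hqd : P.qd ≠ 0) {z : ℂ} (hz : z ≠ 0) : P.plus z⁻¹ = P.minus z := by
  rw [← P.minus_inv hqd (inv_ne_zero hz), inv_inv]

theorem sig_six_ne_zero (hr : P.r ≠ 0) (ha : ∀ j, P.a j ≠ 0) (hα : P.α ≠ 0) (ht : P.t ≠ 0) :
    P.sig 6 ≠ 0 := by
  have h : P.sig 6 = ∏ j, P.b j := by
    have : Finset.powersetCard 6 (Finset.univ : Finset (Fin 6)) = {Finset.univ} := by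
      simpa using Finset.powersetCard_self (Finset.univ : Finset (Fin 6))
    rw [sig, this, Finset.sum_singleton]
  rw [h, Finset.prod_ne_zero_iff]
  intro j _
  fin_cases j <;> simp [b, hr, ha, hα, ht]

/-- The mean of `q^{1/2}` and `q^{-1/2}`. -/
def qm : ℂ := (P.r + P.r⁻¹) / 2

theorem yp_eq (z : ℂ) : P.yp z = P.qm * xOf z + P.dy z / 2 := by
  simp only [dy, yp, ym, xOf, qm, mul_inv, inv_inv]
  ring

theorem ym_eq (z : ℂ) : P.ym z = P.qm * xOf z - P.dy z / 2 := by
  simp only [dy, yp, ym, xOf, qm, mul_inv, inv_inv]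
  ring

theorem dy_sq {z : ℂ} (hz : z ≠ 0) : P.dy z ^ 2 = P.qd ^ 2 * (xOf z ^ 2 - 1) := by
  rw [dy_eq, xOf]
  field_simp
  ring

/-- With X = x(z) and x = x(ζ), both products equal X² + x² - 2 `qm` X x + `qd`²/4, which is
symmetric in X and x. -/
theorem node_symm (hr : P.r ≠ 0) {z ζ : ℂ} (hz : z ≠ 0) (hζ : ζ ≠ 0) :
    (xOf z - P.yp ζ) * (xOf z - P.ym ζ) = (xOf ζ - P.yp z) * (xOf ζ - P.ym z) := by
  have hm : P.qm ^ 2 = 1 + P.qd ^ 2 / 4 := by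
    rw [qm, qd]
    field_simp
    ring
  rw [P.yp_eq, P.ym_eq, P.yp_eq, P.ym_eq]
  linear_combination (xOf ζ ^ 2 - xOf z ^ 2) * hm + P.dy_sq hz / 4 - P.dy_sq hζ / 4

/-- The polynomial part of the Cauchy kernel under the divided-difference operator. -/
def kerG (X x : ℂ) : ℂ :=
  8 / P.qd * (P.sig 6 * P.r - P.r⁻¹) * X + 8 / P.qd * (P.sig 6 * P.r ^ 2 - (P.r ^ 2)⁻¹) * x
    + 4 / P.qd * (P.sig 1 * P.r⁻¹ - P.sig 5 * P.r)

set_option maxHeartbeats 1600000 in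
-- Divided by the node products, which agree by `node_symm`, this says that the difference operator
-- acting in ζ on the kernel 1/(X - x) equals the one acting in z, up to `kerG`. That remainder is
-- affine in each variable, so applying `L` to it leaves a polynomial in X.
theorem kernel_identity (hr : P.r ≠ 0) (hqd : P.qd ≠ 0) {z ζ : ℂ} (hz : z ≠ 0) (hζ : ζ ≠ 0) :
    P.dy ζ * (P.minus z * (P.ym z - xOf ζ) - P.plus z * (P.yp z - xOf ζ))
      = P.dy z * (P.minus (P.r⁻¹ * ζ) * (xOf z - P.yp ζ) - P.plus (P.r * ζ) * (xOf z - P.ym ζ))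
        - P.dy z * P.dy ζ * ((xOf ζ - P.yp z) * (xOf ζ - P.ym z)) * P.kerG (xOf z) (xOf ζ) := by
  have hG : P.dy z * P.dy ζ * ((xOf ζ - P.yp z) * (xOf ζ - P.ym z)) * P.kerG (xOf z) (xOf ζ)
      = P.qd * (z - z⁻¹) * (ζ - ζ⁻¹) * ((xOf ζ - P.yp z) * (xOf ζ - P.ym z)) *
        (2 * (P.sig 6 * P.r - P.r⁻¹) * xOf z + 2 * (P.sig 6 * P.r ^ 2 - (P.r ^ 2)⁻¹) * xOf ζ
          + (P.sig 1 * P.r⁻¹ - P.sig 5 * P.r)) := by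
    rw [dy_eq, dy_eq, kerG]
    field_simp
    ring
  rw [hG, P.minus_eq hqd _ hz, P.plus_eq hqd _ hz,
    P.minus_eq hqd _ (mul_ne_zero (inv_ne_zero hr) hζ), P.plus_eq hqd _ (mul_ne_zero hr hζ)]
  simp only [prod_one_sub, sig_zero, dy_eq, yp, ym, xOf, qd, mul_inv, inv_inv]
  field_simp
  ring

end Params

/-! ### Bounded functionals and functions of the second kind -/

/-- `L` is a bounded linear functional on the functions that are continuous on the closed disc of
radius `B`. -/
structure IsBoundedFunctional (L : (ℂ → ℂ) → ℂ) (B K : ℝ) : Prop where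
  add : ∀ φ ψ : ℂ → ℂ, ContinuousOn φ (closedBall 0 B) → ContinuousOn ψ (closedBall 0 B) →
    L (fun y => φ y + ψ y) = L φ + L ψ
  smul : ∀ (c : ℂ) (φ : ℂ → ℂ), ContinuousOn φ (closedBall 0 B) →
    L (fun y => c * φ y) = c * L φ
  bound : ∀ (φ : ℂ → ℂ) (M : ℝ), ContinuousOn φ (closedBall 0 B) →
    (∀ y ∈ closedBall (0 : ℂ) B, ‖φ y‖ ≤ M) → ‖L φ‖ ≤ K * M

theorem sub_ne_zero_of_mem_closedBall {B : ℝ} {x y : ℂ} (hx : B < ‖x‖)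
    (hy : y ∈ closedBall (0 : ℂ) B) : x - y ≠ 0 := by
  intro h
  rw [mem_closedBall_zero_iff, ← sub_eq_zero.1 h] at hy
  exact absurd hx hy.not_gt

theorem continuousOn_eval_div_sub {B : ℝ} {x : ℂ} (hx : B < ‖x‖) (g : ℂ[X]) :
    ContinuousOn (fun y => g.eval y / (x - y)) (closedBall 0 B) :=
  g.continuous.continuousOn.div (by fun_prop) fun _ hy => sub_ne_zero_of_mem_closedBall hx hy

namespace IsBoundedFunctional

variable {L : (ℂ → ℂ) → ℂ} {B K : ℝ}

/-- The bound with M = 0 shows that `L` sees only the values on the disc. -/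
theorem congr (hL : IsBoundedFunctional L B K) {φ ψ : ℂ → ℂ}
    (hψ : ContinuousOn ψ (closedBall 0 B))
    (h : ∀ y ∈ closedBall (0 : ℂ) B, φ y = ψ y) : L φ = L ψ := by
  have hd : ContinuousOn (fun y => φ y - ψ y) (closedBall 0 B) :=
    (continuousOn_const (c := (0 : ℂ))).congr fun y hy => by simp [h y hy]
  have h0 : L (fun y => φ y - ψ y) = 0 := by
    have := hL.bound _ 0 hd fun y hy => by simp [h y hy]
    simpa using this
  have := hL.add _ _ hψ hd
  simpa [h0] using this

theorem eval_add (hL : IsBoundedFunctional L B K) (g h : ℂ[X]) :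
    L (fun y => (g + h).eval y) = L (fun y => g.eval y) + L (fun y => h.eval y) := by
  simpa using hL.add _ _ g.continuous.continuousOn h.continuous.continuousOn

theorem eval_C_mul (hL : IsBoundedFunctional L B K) (c : ℂ) (g : ℂ[X]) :
    L (fun y => (C c * g).eval y) = c * L (fun y => g.eval y) := by
  simpa using hL.smul c _ g.continuous.continuousOn

theorem eval_zero (hL : IsBoundedFunctional L B K) : L (fun y => (0 : ℂ[X]).eval y) = 0 := by
  simpa using hL.eval_C_mul 0 0

/-- Under `L` the terms in g(x) cancel: g(x)/(x - y) - (g(y) - g(x))/(y - x) = g(y)/(x - y). -/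
theorem secondKind_eq (hL : IsBoundedFunctional L B K) (g : ℂ[X]) {x : ℂ} (hx : B < ‖x‖) :
    secondKind L g x = L fun y => g.eval y / (x - y) := by
  have h1 : ContinuousOn (fun y : ℂ => 1 / (x - y)) (closedBall 0 B) := by
    simpa using continuousOn_eval_div_sub hx 1
  have h2 : ContinuousOn (fun y : ℂ => (g.eval y - g.eval x) / (y - x)) (closedBall 0 B) :=
    (by fun_prop : ContinuousOn (fun y : ℂ => g.eval y - g.eval x) _).div (by fun_prop)
      fun y hy => by
        rw [← neg_sub]
        exact neg_ne_zero.2 (sub_ne_zero_of_mem_closedBall hx hy)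
  have h3 := hL.add (fun y => g.eval x * (1 / (x - y)))
    (fun y => (-1) * ((g.eval y - g.eval x) / (y - x))) (continuousOn_const.mul h1)
    (continuousOn_const.mul h2)
  rw [hL.smul _ _ h1, hL.smul _ _ h2] at h3
  rw [secondKind, stieltjes, associated, ← hL.congr (φ := fun y => g.eval x * (1 / (x - y)) +
    (-1) * ((g.eval y - g.eval x) / (y - x))) (continuousOn_eval_div_sub hx g), h3]
  · ring
  · intro y hy
    have := sub_ne_zero_of_mem_closedBall hx hy
    have : y - x ≠ 0 := by rwa [← neg_sub, neg_ne_zero]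
    field_simp
    ring

theorem exists_associated_eq (hL : IsBoundedFunctional L B K) (g : ℂ[X]) :
    ∃ a : ℂ[X], ∀ x : ℂ, B < ‖x‖ → associated L g x = a.eval x := by
  have hc : ∀ (g : ℂ[X]) {x : ℂ}, B < ‖x‖ →
      ContinuousOn (fun y : ℂ => (g.eval y - g.eval x) / (y - x)) (closedBall 0 B) := by
    intro g x hx
    refine (by fun_prop : ContinuousOn (fun y : ℂ => g.eval y - g.eval x) _).div (by fun_prop)
      fun y hy => ?_
    rw [← neg_sub]
    exact neg_ne_zero.2 (sub_ne_zero_of_mem_closedBall hx hy)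
  induction g using Polynomial.induction_on with
  | C c =>
    refine ⟨0, fun x hx => ?_⟩
    have := hL.eval_zero
    simpa [associated] using this
  | add g h hg hh =>
    obtain ⟨a, ha⟩ := hg
    obtain ⟨b, hb⟩ := hh
    refine ⟨a + b, fun x hx => ?_⟩
    rw [Polynomial.eval_add, ← ha x hx, ← hb x hx, associated, associated, associated,
      ← hL.add _ _ (hc g hx) (hc h hx)]
    congr 1
    ext y
    rw [Polynomial.eval_add, Polynomial.eval_add]
    ring
  | monomial m c ih =>
    obtain ⟨a, ha⟩ := ih
    -- The recursion (y^{m+1} - x^{m+1})/(y - x) = y^m + x (y^m - x^m)/(y - x), with `L` applied in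
    -- y.
    refine ⟨C (L fun y => (C c * X ^ m : ℂ[X]).eval y) + X * a, fun x hx => ?_⟩
    rw [Polynomial.eval_add, eval_C, eval_mul, eval_X, ← ha x hx, associated, associated,
      ← hL.smul _ _ (hc _ hx), ← hL.add _ (fun y => x * _) (Polynomial.continuous _).continuousOn
        (continuousOn_const.mul (hc _ hx))]
    refine hL.congr ?_ fun y hy => ?_
    · exact (Polynomial.continuous _).continuousOn.add (continuousOn_const.mul (hc _ hx))
    · have := sub_ne_zero_of_mem_closedBall hx hy
      have : y - x ≠ 0 := by rwa [← neg_sub, neg_ne_zero]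
      simp only [eval_mul, eval_C, eval_pow, eval_X]
      field_simp
      ring

theorem mul_eval_div_sub (hL : IsBoundedFunctional L B K) (g : ℂ[X]) {x : ℂ} (hx : B < ‖x‖) :
    x * L (fun y => g.eval y / (x - y))
      = L (fun y => g.eval y) + L (fun y => (X * g).eval y / (x - y)) := by
  rw [← hL.smul _ _ (continuousOn_eval_div_sub hx g),
    ← hL.add _ _ g.continuous.continuousOn (continuousOn_eval_div_sub hx _)]
  refine hL.congr (g.continuous.continuousOn.add (continuousOn_eval_div_sub hx _)) fun y hy => ?_
  have := sub_ne_zero_of_mem_closedBall hx hy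
  simp only [eval_mul, eval_X]
  field_simp
  ring

theorem tendsto_eval_div_sub (hL : IsBoundedFunctional L B K) (g : ℂ[X]) :
    Tendsto (fun x => L (fun y => g.eval y / (x - y))) (cobounded ℂ) (𝓝 0) := by
  obtain ⟨M, hM⟩ := (isCompact_closedBall (0 : ℂ) B).exists_bound_of_continuousOn
    g.continuous.continuousOn
  have hlim : Tendsto (fun x : ℂ => K * (|M| / (‖x‖ - B))) (cobounded ℂ) (𝓝 0) := by
    rw [← mul_zero K]
    refine Tendsto.const_mul _ (Tendsto.const_div_atTop ?_ _)
    exact tendsto_atTop_add_const_right _ (-B) tendsto_norm_cobounded_atTop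
  refine squeeze_zero_norm' ?_ hlim
  filter_upwards [tendsto_norm_cobounded_atTop.eventually_gt_atTop B] with x hx
  refine hL.bound _ _ (continuousOn_eval_div_sub hx g) fun y hy => ?_
  rw [norm_div]
  have h1 : ‖x‖ - B ≤ ‖x - y‖ := by
    have := norm_sub_norm_le x y
    rw [mem_closedBall_zero_iff] at hy
    linarith
  have h2 : 0 < ‖x‖ - B := by linarith
  have h3 := (hM y hy).trans (le_abs_self M)
  gcongr

/-- Since x/(x - y) = 1 + y/(x - y), each vanishing moment lets one more factor x pass inside `L` as
y; one further factor x then isolates the k-th moment as the limit. -/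
theorem tendsto_pow_mul_secondKind (hL : IsBoundedFunctional L B K) (g : ℂ[X]) (k : ℕ)
    (h : ∀ j < k, L (fun y => (X ^ j * g).eval y) = 0) :
    Tendsto (fun x => x ^ (k + 1) * secondKind L g x) (cobounded ℂ)
      (𝓝 (L fun y => (X ^ k * g).eval y)) := by
  have key : ∀ x : ℂ, B < ‖x‖ → ∀ m ≤ k, x ^ m * L (fun y => g.eval y / (x - y))
      = L (fun y => (X ^ m * g).eval y / (x - y)) := by
    intro x hx m
    induction m with
    | zero => simp
    | succ m ih =>
      intro hm
      rw [pow_succ', mul_assoc, ih (by omega), hL.mul_eval_div_sub _ hx, h m (by omega), zero_add,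
        pow_succ', mul_assoc]
  have hlim := (hL.tendsto_eval_div_sub (X * (X ^ k * g))).const_add
    (L fun y => (X ^ k * g).eval y)
  rw [add_zero] at hlim
  refine hlim.congr' ?_
  filter_upwards [tendsto_norm_cobounded_atTop.eventually_gt_atTop B] with x hx
  rw [← hL.mul_eval_div_sub _ hx, ← key x hx k le_rfl, hL.secondKind_eq _ hx]
  ring

end IsBoundedFunctional

/-! ### Orthogonality and the decay of the functions of the second kind -/

namespace IsOrthonormalUpTo

variable {L : (ℂ → ℂ) → ℂ} {B K : ℝ} {p : ℕ → ℂ[X]} {n : ℕ}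

theorem ne_zero (hL : IsBoundedFunctional L B K) (hp : IsOrthonormalUpTo L p n) {k : ℕ}
    (hk : k ≤ n) : p k ≠ 0 := by
  intro h
  have h1 := hp.2 k hk k hk
  have h0 := hL.eval_zero
  simp only [h, Polynomial.eval_zero, mul_zero, if_true] at h0 h1
  exact one_ne_zero (h1.symm.trans h0)

theorem mono (hp : IsOrthonormalUpTo L p n) {m : ℕ} (hm : m ≤ n) : IsOrthonormalUpTo L p m :=
  ⟨fun k hk => hp.1 k (hk.trans hm), fun j hj k hk => hp.2 j (hj.trans hm) k (hk.trans hm)⟩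

/-- Induction on the degree bound, with n fixed: subtracting a multiple of `p m`, itself orthogonal
to `p n`, removes the coefficient of degree m. -/
theorem orthogonal_of_degree_lt (hL : IsBoundedFunctional L B K) (hp : IsOrthonormalUpTo L p n)
    (m : ℕ) (hm : m ≤ n) (g : ℂ[X]) (hg : g.degree < m) :
    L (fun y => (g * p n).eval y) = 0 := by
  induction m generalizing g with
  | zero =>
    have : g = 0 := by simpa using hg
    rw [this, zero_mul, hL.eval_zero]
  | succ m ih =>
    have hm0 := hp.ne_zero hL (show m ≤ n by omega)
    have hlc : (p m).leadingCoeff ≠ 0 := leadingCoeff_ne_zero.2 hm0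
    set c := g.coeff m / (p m).leadingCoeff with hc
    have hd : (g - C c * p m).degree < m := by
      rw [degree_lt_iff_coeff_zero]
      intro j hj
      rcases hj.eq_or_lt with rfl | hj
      · have : (p m).coeff m = (p m).leadingCoeff := by
          rw [leadingCoeff, hp.1 m (by omega)]
        rw [coeff_sub, coeff_C_mul, this, hc, div_mul_cancel₀ _ hlc, sub_self]
      · rw [coeff_sub, coeff_C_mul,
          coeff_eq_zero_of_degree_lt (lt_of_lt_of_le hg (by exact_mod_cast hj)),
          coeff_eq_zero_of_natDegree_lt (by rw [hp.1 m (by omega)]; exact hj), mul_zero, sub_zero]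
    have h1 := ih (by omega) _ hd
    have h2 : L (fun y => (p m * p n).eval y) = 0 := by
      have := hp.2 m (by omega) n le_rfl
      rw [if_neg (by omega)] at this
      simpa using this
    have h3 : g * p n = (g - C c * p m) * p n + C c * (p m * p n) := by ring
    rw [h3, hL.eval_add, h1, hL.eval_C_mul, h2, mul_zero, add_zero]

/-- X^n and p_n/γ_n differ by a polynomial of degree below n, to which p_n is orthogonal. -/
theorem moment_eq (hL : IsBoundedFunctional L B K) (hp : IsOrthonormalUpTo L p n) :
    L (fun y => (X ^ n * p n).eval y) = 1 / (p n).leadingCoeff := by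
  have hlc : (p n).leadingCoeff ≠ 0 := leadingCoeff_ne_zero.2 (hp.ne_zero hL le_rfl)
  have hd : (X ^ n - C (1 / (p n).leadingCoeff) * p n : ℂ[X]).degree < n := by
    rw [degree_lt_iff_coeff_zero]
    intro j hj
    rcases hj.eq_or_lt with rfl | hj
    · have : (p n).coeff n = (p n).leadingCoeff := by rw [leadingCoeff, hp.1 n le_rfl]
      rw [coeff_sub, coeff_C_mul, this, coeff_X_pow_self, one_div, inv_mul_cancel₀ hlc, sub_self]
    · rw [coeff_sub, coeff_C_mul, coeff_X_pow, if_neg (by omega),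
        coeff_eq_zero_of_natDegree_lt (by rw [hp.1 n le_rfl]; exact hj), mul_zero, sub_zero]
  have h1 := hp.orthogonal_of_degree_lt hL n le_rfl _ hd
  have h2 : L (fun y => (p n * p n).eval y) = 1 := by
    have := hp.2 n le_rfl n le_rfl
    rw [if_pos rfl] at this
    simpa using this
  have h3 : X ^ n * p n = (X ^ n - C (1 / (p n).leadingCoeff) * p n) * p n
      + C (1 / (p n).leadingCoeff) * (p n * p n) := by ring
  rw [h3, hL.eval_add, h1, hL.eval_C_mul, h2, mul_one, zero_add]

theorem tendsto_secondKind (hL : IsBoundedFunctional L B K) (hp : IsOrthonormalUpTo L p n) :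
    Tendsto (fun x => x ^ (n + 1) * secondKind L (p n) x) (cobounded ℂ)
      (𝓝 (1 / (p n).leadingCoeff)) := by
  rw [← hp.moment_eq hL]
  refine hL.tendsto_pow_mul_secondKind _ _ fun j hj => ?_
  refine hp.orthogonal_of_degree_lt hL n le_rfl _ ?_
  rw [degree_X_pow]
  exact_mod_cast hj

end IsOrthonormalUpTo

/-! ### Reading degrees and coefficients from growth at infinity -/

/-- The quotient is the reflected polynomial at 1/u, which is continuous at 0. -/
theorem tendsto_eval_div_pow {ι : Type*} {l : Filter ι} {u : ι → ℂ}
    (hu : Tendsto u l (cobounded ℂ)) (g : ℂ[X]) {N : ℕ} (hN : g.natDegree ≤ N) :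
    Tendsto (fun i => g.eval (u i) / u i ^ N) l (𝓝 (g.coeff N)) := by
  have h1 : Tendsto (fun i => (reflect N g).eval (u i)⁻¹) l (𝓝 ((reflect N g).eval 0)) :=
    ((reflect N g).continuous.tendsto 0).comp (tendsto_inv₀_cobounded.comp hu)
  have h2 : (reflect N g).eval 0 = g.coeff N := by
    rw [← coeff_zero_eq_eval_zero, coeff_reflect]
    simp
  rw [h2] at h1
  refine h1.congr' ?_
  filter_upwards [hu.eventually (eventually_ne_cobounded 0)] with i hi
  let _ := invertibleOfNonzero hi
  have h3 := eval₂_reflect_mul_pow (RingHom.id ℂ) (u i) N g hN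
  rw [invOf_eq_inv] at h3
  exact eq_div_of_mul_eq (pow_ne_zero N hi) h3

/-- If the degree exceeded k, dividing by the missing powers of u would force the leading
coefficient to be 0. -/
theorem natDegree_le_and_coeff_eq_of_tendsto {ι : Type*} {l : Filter ι} [l.NeBot] {u : ι → ℂ}
    (hu : Tendsto u l (cobounded ℂ)) (g : ℂ[X]) (k : ℕ) {c : ℂ}
    (h : Tendsto (fun i => g.eval (u i) / u i ^ k) l (𝓝 c)) :
    g.natDegree ≤ k ∧ g.coeff k = c := by
  have hinv : Tendsto (fun i => (u i)⁻¹) l (𝓝 0) := tendsto_inv₀_cobounded.comp hu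
  have hd : g.natDegree ≤ k := by
    by_contra! hlt
    have h1 := tendsto_eval_div_pow hu g le_rfl
    have h2 : Tendsto (fun i => g.eval (u i) / u i ^ k * (u i)⁻¹ ^ (g.natDegree - k)) l (𝓝 0) := by
      have := h.mul (hinv.pow (g.natDegree - k))
      rwa [zero_pow (by omega), mul_zero] at this
    have h3 : g.leadingCoeff = 0 := by
      refine tendsto_nhds_unique h1 (h2.congr fun i => ?_)
      rw [inv_pow, ← div_eq_mul_inv, div_div, ← pow_add, Nat.add_sub_cancel' hlt.le]
    rw [leadingCoeff_eq_zero.1 h3] at hlt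
    simp at hlt
  exact ⟨hd, tendsto_nhds_unique (tendsto_eval_div_pow hu g hd) h⟩

theorem tendsto_xOf_div : Tendsto (fun z : ℂ => xOf z / z) (cobounded ℂ) (𝓝 (1 / 2)) := by
  have h : Tendsto (fun z : ℂ => (1 + z⁻¹ ^ 2) / 2) (cobounded ℂ) (𝓝 ((1 + 0 ^ 2) / 2)) :=
    ((tendsto_inv₀_cobounded.pow 2).const_add 1).div_const 2
  rw [show ((1 : ℂ) + 0 ^ 2) / 2 = 1 / 2 by norm_num] at h
  refine h.congr' ?_
  filter_upwards [eventually_ne_cobounded 0] with z hz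
  rw [xOf]
  field_simp

theorem tendsto_xOf : Tendsto xOf (cobounded ℂ) (cobounded ℂ) := by
  rw [← tendsto_norm_atTop_iff_cobounded]
  have h : Tendsto (fun z : ℂ => (‖z‖ - 1) / 2) (cobounded ℂ) atTop :=
    (tendsto_atTop_add_const_right _ (-1) tendsto_norm_cobounded_atTop).atTop_div_const two_pos
  refine tendsto_atTop_mono' _ ?_ h
  filter_upwards [tendsto_norm_cobounded_atTop.eventually_ge_atTop 1] with z hz
  rw [xOf, norm_div, RCLike.norm_ofNat]
  have h1 := norm_sub_norm_le z (-z⁻¹)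
  rw [sub_neg_eq_add, norm_neg, norm_inv] at h1
  have h2 := inv_le_one_of_one_le₀ hz
  linarith

theorem tendsto_mul_cobounded {c : ℂ} (hc : c ≠ 0) :
    Tendsto (fun z => c * z) (cobounded ℂ) (cobounded ℂ) :=
  tendsto_mul_left_cobounded hc

theorem eq_of_eventually_eval_xOf {g h : ℂ[X]}
    (H : ∀ᶠ z in cobounded ℂ, g.eval (xOf z) = h.eval (xOf z)) : g = h := by
  have h1 : Tendsto (fun z => (g - h).eval (xOf z) / xOf z ^ 0) (cobounded ℂ) (𝓝 0) := by
    refine tendsto_const_nhds.congr' ?_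
    filter_upwards [H] with z hz
    simp [hz]
  obtain ⟨h2, h3⟩ := natDegree_le_and_coeff_eq_of_tendsto tendsto_xOf _ _ h1
  rw [← sub_eq_zero, eq_C_of_natDegree_le_zero h2, h3, C_0]

/-- The factor 2^k comes from x/z → 1/2. -/
theorem coeff_of_tendsto_xOf {g : ℂ[X]} {k : ℕ} {c : ℂ}
    (h : Tendsto (fun z => g.eval (xOf z) / z ^ k) (cobounded ℂ) (𝓝 c)) :
    g.natDegree ≤ k ∧ g.coeff k = 2 ^ k * c := by
  refine natDegree_le_and_coeff_eq_of_tendsto tendsto_xOf _ _ ?_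
  have h1 := ((tendsto_xOf_div.inv₀ (by norm_num)).pow k).mul h
  rw [show ((1 : ℂ) / 2)⁻¹ = 2 by norm_num] at h1
  refine h1.congr' ?_
  filter_upwards [eventually_ne_cobounded 0, tendsto_xOf.eventually (eventually_ne_cobounded 0)]
    with z hz hx
  rw [inv_div, div_pow]
  field_simp

namespace Params

variable (P : Params)

theorem tendsto_yp (hr : P.r ≠ 0) : Tendsto P.yp (cobounded ℂ) (cobounded ℂ) :=
  tendsto_xOf.comp (tendsto_mul_cobounded hr)

theorem tendsto_ym (hr : P.r ≠ 0) : Tendsto P.ym (cobounded ℂ) (cobounded ℂ) :=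
  tendsto_xOf.comp (tendsto_mul_cobounded (inv_ne_zero hr))

theorem tendsto_xOf_mul_div {c : ℂ} (hc : c ≠ 0) :
    Tendsto (fun z => xOf (c * z) / z) (cobounded ℂ) (𝓝 (c / 2)) := by
  have h := (tendsto_xOf_div.comp (tendsto_mul_cobounded hc)).const_mul c
  rw [show c * (1 / 2) = c / 2 by ring] at h
  refine h.congr' ?_
  filter_upwards [eventually_ne_cobounded 0] with z hz
  simp only [Function.comp]
  field_simp

theorem tendsto_plus (hqd : P.qd ≠ 0) :
    Tendsto (fun z => P.plus z / z ^ 3) (cobounded ℂ) (𝓝 (P.sig 6)) := by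
  have h : Continuous fun v : ℂ => v ^ 6 - P.sig 1 * v ^ 5 + P.sig 2 * v ^ 4 - P.sig 3 * v ^ 3
      + P.sig 4 * v ^ 2 - P.sig 5 * v + P.sig 6 := by fun_prop
  have h1 := (h.tendsto 0).comp tendsto_inv₀_cobounded
  norm_num at h1
  refine h1.congr' ?_
  filter_upwards [eventually_ne_cobounded 0] with z hz
  rw [P.plus_eq hqd z hz, prod_one_sub, sig_zero]
  simp only [Function.comp]
  field_simp

theorem tendsto_minus (hqd : P.qd ≠ 0) :
    Tendsto (fun z => P.minus z / z ^ 3) (cobounded ℂ) (𝓝 1) := by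
  have h : Continuous fun v : ℂ => ∏ j, (1 - P.b j * v) := by fun_prop
  have h1 := (h.tendsto 0).comp tendsto_inv₀_cobounded
  simp only [mul_zero, sub_zero, Finset.prod_const_one] at h1
  refine h1.congr' ?_
  filter_upwards [eventually_ne_cobounded 0] with z hz
  rw [P.minus_eq hqd z hz]
  simp only [Function.comp]
  field_simp

theorem tendsto_dy : Tendsto (fun z => P.dy z / z) (cobounded ℂ) (𝓝 (P.qd / 2)) := by
  have h : Tendsto (fun z : ℂ => P.qd * (1 - z⁻¹ ^ 2) / 2) (cobounded ℂ)
      (𝓝 (P.qd * (1 - 0 ^ 2) / 2)) :=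
    (((tendsto_inv₀_cobounded.pow 2).const_sub 1).const_mul P.qd).div_const 2
  rw [show P.qd * (1 - 0 ^ 2) / 2 = P.qd / 2 by ring] at h
  refine h.congr' ?_
  filter_upwards [eventually_ne_cobounded 0] with z hz
  rw [dy_eq]
  field_simp

/-- One limit serves every product in the spectral coefficients: F is W ± Δy V, f grows like u^a, g
decays like u^{-b}, and {c, d} = {r, r⁻¹} selects the nodes. -/
theorem tendsto_bilinear {F : ℂ → ℂ} {w : ℂ}
    (hF : Tendsto (fun z => F z / z ^ 3) (cobounded ℂ) (𝓝 w))
    {f g : ℂ → ℂ} {a b : ℕ} {α β c d : ℂ} (hc : c ≠ 0) (hd : d ≠ 0)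
    (hf : Tendsto (fun u => f u / u ^ a) (cobounded ℂ) (𝓝 α))
    (hg : Tendsto (fun u => u ^ b * g u) (cobounded ℂ) (𝓝 β)) :
    Tendsto (fun z => F z * f (xOf (c * z)) * g (xOf (d * z)) * (z ^ b / z ^ (a + 3)))
      (cobounded ℂ) (𝓝 (w * (α * (c / 2) ^ a) * (β * (2 / d) ^ b))) := by
  have hyc := tendsto_xOf.comp (tendsto_mul_cobounded hc)
  have hyd := tendsto_xOf.comp (tendsto_mul_cobounded hd)
  have h1 := (hf.comp hyc).mul ((tendsto_xOf_mul_div hc).pow a)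
  have h2 := (hg.comp hyd).mul
    (((tendsto_xOf_mul_div hd).inv₀ (div_ne_zero hd two_ne_zero)).pow b)
  rw [inv_div] at h2
  refine ((hF.mul h1).mul h2).congr' ?_
  filter_upwards [eventually_ne_cobounded 0, hyc.eventually (eventually_ne_cobounded 0),
    hyd.eventually (eventually_ne_cobounded 0)] with z hz hzc hzd
  simp only [Function.comp] at hzc hzd ⊢
  rw [inv_div, div_pow, div_pow, pow_add]
  generalize xOf (c * z) = s at hzc ⊢
  generalize xOf (d * z) = t at hzd ⊢
  field_simp

/-- The polynomial in `x` that is the square of `Δy`. -/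
def dySq : ℂ[X] := C (P.qd ^ 2) * (X ^ 2 - 1)

theorem eval_dySq {z : ℂ} (hz : z ≠ 0) : P.dySq.eval (xOf z) = P.dy z ^ 2 := by
  simp [dySq, P.dy_sq hz]

/-- The nodes are `qm` x ± Δy/2 and Δy² is a polynomial in x, so exchanging the nodes is conjugation
in a quadratic extension of ℂ[x]. -/
theorem exists_eval_nodes (g : ℂ[X]) : ∃ A B : ℂ[X], ∀ z : ℂ, z ≠ 0 →
    g.eval (P.yp z) = A.eval (xOf z) + P.dy z * B.eval (xOf z) ∧
    g.eval (P.ym z) = A.eval (xOf z) - P.dy z * B.eval (xOf z) := by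
  induction g using Polynomial.induction_on with
  | C c => exact ⟨C c, 0, fun z _ => by simp⟩
  | add g h hg hh =>
    obtain ⟨A, B, hA⟩ := hg
    obtain ⟨A', B', hA'⟩ := hh
    refine ⟨A + A', B + B', fun z hz => ?_⟩
    obtain ⟨h1, h2⟩ := hA z hz
    obtain ⟨h3, h4⟩ := hA' z hz
    simp only [eval_add, h1, h2, h3, h4]
    constructor <;> ring
  | monomial m c ih =>
    obtain ⟨A, B, hA⟩ := ih
    refine ⟨C P.qm * X * A + C (1 / 2) * P.dySq * B, C (1 / 2) * A + C P.qm * X * B,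
      fun z hz => ?_⟩
    obtain ⟨h1, h2⟩ := hA z hz
    rw [pow_succ, ← mul_assoc, eval_mul, eval_mul (q := X), h1, h2, eval_X, eval_X, P.yp_eq,
      P.ym_eq]
    simp only [eval_add, eval_mul, eval_C, eval_X, P.eval_dySq hz]
    constructor <;> ring

end Params

/-! ### Polynomial spectral coefficients and the quadratic identity -/

namespace Params

variable (P : Params)

/-- The terms in f combine to -p(y₊) p(y₋) Δy U. The rest is antisymmetric under exchange of the
nodes, hence Δy times a polynomial in x. -/
theorem exists_theta {f : ℂ → ℂ} {U : ℂ[X]}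
    (hF : ∀ᶠ z in cobounded ℂ,
      P.minus z * f (P.yp z) - P.plus z * f (P.ym z) = P.dy z * U.eval (xOf z))
    (p a : ℂ[X]) : ∃ Θ : ℂ[X], ∀ᶠ z in cobounded ℂ, P.dy z * Θ.eval (xOf z)
      = P.plus z * p.eval (P.yp z) * (f (P.ym z) * p.eval (P.ym z) - a.eval (P.ym z))
        - P.minus z * p.eval (P.ym z) * (f (P.yp z) * p.eval (P.yp z) - a.eval (P.yp z)) := by
  obtain ⟨A, B, hp⟩ := P.exists_eval_nodes p
  obtain ⟨E, F, ha⟩ := P.exists_eval_nodes a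
  refine ⟨-(U * (A ^ 2 - P.dySq * B ^ 2))
    - C 2 * (P.W * (B * E - A * F) + P.V * (A * E - P.dySq * B * F)), ?_⟩
  filter_upwards [hF, eventually_ne_cobounded 0] with z hz hz0
  obtain ⟨h1, h2⟩ := hp z hz0
  obtain ⟨h3, h4⟩ := ha z hz0
  simp only [eval_sub, eval_neg, eval_mul, eval_add, eval_pow, eval_C, P.eval_dySq hz0,
    h1, h2, h3, h4]
  rw [plus, minus] at hz ⊢
  linear_combination
    (A.eval (xOf z) ^ 2 - P.dy z ^ 2 * B.eval (xOf z) ^ 2) * hz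

/-- In the first combination f is multiplied by p(y₊) p'(y₋) - p'(y₊) p(y₋), which is divisible by
Δy; with the Δy of the difference equation this contributes a multiple of Δy². Modulo Δy² what
remains is W times the Casoratian. Keeping the form W + Δy² G records the values at x = ±1. -/
theorem exists_coefficients {f : ℂ → ℂ} {U : ℂ[X]}
    (hF : ∀ᶠ z in cobounded ℂ,
      P.minus z * f (P.yp z) - P.plus z * f (P.ym z) = P.dy z * U.eval (xOf z))
    {p p' a a' : ℂ[X]} {κ : ℂ} (hκ : κ ≠ 0) (hcas : p' * a - p * a' = C (1 / κ)) :
    ∃ G M : ℂ[X], ∀ᶠ z in cobounded ℂ,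
      (2 / κ * (P.W + P.dySq * G).eval (xOf z)
        = P.plus z * (p.eval (P.yp z) * (f (P.ym z) * p'.eval (P.ym z) - a'.eval (P.ym z))
            - p'.eval (P.yp z) * (f (P.ym z) * p.eval (P.ym z) - a.eval (P.ym z)))
          + P.minus z * (p.eval (P.ym z) * (f (P.yp z) * p'.eval (P.yp z) - a'.eval (P.yp z))
            - p'.eval (P.ym z) * (f (P.yp z) * p.eval (P.yp z) - a.eval (P.yp z)))) ∧
      (2 * P.dy z / κ * M.eval (xOf z)
        = P.plus z * (p.eval (P.yp z) * (f (P.ym z) * p'.eval (P.ym z) - a'.eval (P.ym z))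
            + p'.eval (P.yp z) * (f (P.ym z) * p.eval (P.ym z) - a.eval (P.ym z)))
          + P.minus z * (-(p.eval (P.ym z) * (f (P.yp z) * p'.eval (P.yp z) - a'.eval (P.yp z)))
            - p'.eval (P.ym z) * (f (P.yp z) * p.eval (P.yp z) - a.eval (P.yp z)))) := by
  obtain ⟨A, B, hp⟩ := P.exists_eval_nodes p
  obtain ⟨A', B', hp'⟩ := P.exists_eval_nodes p'
  obtain ⟨E, F, ha⟩ := P.exists_eval_nodes a
  obtain ⟨E', F', ha'⟩ := P.exists_eval_nodes a'
  refine ⟨C κ * (-(C 2 * P.W * (B' * F - B * F')) + P.V * (B' * E - A' * F - B * E' + A * F')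
      - (B * A' - A * B') * U),
    -(C κ * ((A * A' - P.dySq * B * B') * U
      + P.V * (A * E' - P.dySq * B * F' + A' * E - P.dySq * B' * F)
      + P.W * (B * E' - A * F' + B' * E - A' * F))), ?_⟩
  filter_upwards [hF, eventually_ne_cobounded 0] with z hz hz0
  obtain ⟨h1, h2⟩ := hp z hz0
  obtain ⟨h3, h4⟩ := hp' z hz0
  obtain ⟨h5, h6⟩ := ha z hz0
  obtain ⟨h7, h8⟩ := ha' z hz0
  have c1 := congrArg (eval (P.yp z)) hcas
  have c2 := congrArg (eval (P.ym z)) hcas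
  simp only [eval_sub, eval_mul, eval_C, h1, h2, h3, h4, h5, h6, h7, h8] at c1 c2
  simp only [eval_sub, eval_neg, eval_mul, eval_add, eval_C, P.eval_dySq hz0,
    h1, h2, h3, h4, h5, h6, h7, h8]
  rw [plus, minus] at hz ⊢
  generalize eval (xOf z) A = A at *
  generalize eval (xOf z) B = B at *
  generalize eval (xOf z) A' = A' at *
  generalize eval (xOf z) B' = B' at *
  generalize eval (xOf z) E = E at *
  generalize eval (xOf z) F = F at *
  generalize eval (xOf z) E' = E' at *
  generalize eval (xOf z) F' = F' at *
  constructor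
  · rw [show ∀ w d s : ℂ, 2 / κ * (w + d * (κ * s)) = 2 * w * (1 / κ) + 2 * d * s by
      intro w d s; field_simp]
    linear_combination 2 * P.dy z * (B * A' - A * B') * hz - P.W.eval (xOf z) * (c1 + c2)
  · rw [show ∀ d s : ℂ, 2 * d / κ * (-(κ * s)) = -(2 * d * s) by intro d s; field_simp]
    linear_combination 2 * (A * A' - P.dy z ^ 2 * B * B') * hz

/-- The part of the identity `ν² - W² = Δ (x² - 1) (μ² - V²)` at a general point. -/
theorem conic_identity {p q p' q' : ℂ → ℂ} {κ : ℂ} (hκ : κ ≠ 0) {N M Θ Θ' : ℂ[X]}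
    (hcas : ∀ᶠ u in cobounded ℂ, p u * q' u - p' u * q u = 1 / κ) (hr : P.r ≠ 0)
    (h : ∀ᶠ z in cobounded ℂ,
      (2 / κ * N.eval (xOf z)
        = P.plus z * (p (P.yp z) * q' (P.ym z) - p' (P.yp z) * q (P.ym z))
          + P.minus z * (p (P.ym z) * q' (P.yp z) - p' (P.ym z) * q (P.yp z))) ∧
      (P.dy z * Θ.eval (xOf z)
        = P.plus z * p (P.yp z) * q (P.ym z) - P.minus z * p (P.ym z) * q (P.yp z)) ∧
      (2 * P.dy z / κ * M.eval (xOf z)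
        = P.plus z * (p (P.yp z) * q' (P.ym z) + p' (P.yp z) * q (P.ym z))
          + P.minus z * (-(p (P.ym z) * q' (P.yp z)) - p' (P.ym z) * q (P.yp z))))
    (h' : ∀ᶠ z in cobounded ℂ, P.dy z * Θ'.eval (xOf z)
        = P.plus z * p' (P.yp z) * q' (P.ym z) - P.minus z * p' (P.ym z) * q' (P.yp z)) :
    N ^ 2 - P.dySq * M ^ 2
      = P.W ^ 2 - P.dySq * P.V ^ 2 - C (κ ^ 2) * P.dySq * (Θ * Θ') := by
  refine eq_of_eventually_eval_xOf ?_
  filter_upwards [h, h', eventually_ne_cobounded 0, (P.tendsto_yp hr).eventually hcas,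
    (P.tendsto_ym hr).eventually hcas] with z hz hz' hz0 c1 c2
  obtain ⟨h1, h2, h3⟩ := hz
  simp only [eval_sub, eval_mul, eval_pow, eval_C, P.eval_dySq hz0]
  have e1 : N.eval (xOf z) = κ / 2 * (2 / κ * N.eval (xOf z)) := by field_simp
  have e2 : P.dy z * M.eval (xOf z) = κ / 2 * (2 * P.dy z / κ * M.eval (xOf z)) := by field_simp
  rw [h1] at e1
  rw [h3] at e2
  have e3 : P.plus z * P.minus z
      = P.W.eval (xOf z) ^ 2 - P.dy z ^ 2 * P.V.eval (xOf z) ^ 2 := by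
    rw [plus, minus]
    ring
  have e4 : κ ^ 2 * ((p (P.yp z) * q' (P.yp z) - p' (P.yp z) * q (P.yp z))
      * (p (P.ym z) * q' (P.ym z) - p' (P.ym z) * q (P.ym z))) = 1 := by
    rw [c1, c2]
    field_simp
  have e5 : P.dy z ^ 2 * M.eval (xOf z) ^ 2 = (P.dy z * M.eval (xOf z)) ^ 2 := by ring
  have e6 : κ ^ 2 * P.dy z ^ 2 * (Θ.eval (xOf z) * Θ'.eval (xOf z))
      = κ ^ 2 * ((P.dy z * Θ.eval (xOf z)) * (P.dy z * Θ'.eval (xOf z))) := by ring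
  -- N² - Δy² M² + κ² Δy² Θ Θ' factors as κ² (W + Δy V)(W - Δy V) times the Casoratians at y₊ and
  -- y₋, each equal to 1/κ.
  rw [← e3, e5, e6, e2, e1, h2, hz']
  linear_combination P.plus z * P.minus z * e4

end Params

/-! ### Degrees and leading coefficients of the spectral coefficients -/

namespace Params

variable (P : Params)

theorem brk_natCast (m : ℕ) : P.brk m = P.r ^ m * P.sig 6 - (P.r ^ m)⁻¹ := by
  rw [brk, zpow_neg, zpow_natCast]

theorem brc_natCast (m : ℕ) : P.brc m = P.r ^ m * P.sig 6 + (P.r ^ m)⁻¹ := by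
  rw [brc, zpow_neg, zpow_natCast]

theorem brc_sq_sub_brk_sq (hr : P.r ≠ 0) (m : ℤ) : P.brc m ^ 2 - P.brk m ^ 2 = 4 * P.sig 6 := by
  have : P.r ^ m * P.r ^ (-m) = 1 := by rw [← zpow_add₀ hr]; simp
  rw [brc, brk]
  linear_combination 4 * P.sig 6 * this

/-- In N and M the products p'q are of lower order than pq', which alone determines the top
coefficients. Assuming only p' = o(u^n) includes n = 0, where p' = 0; it suffices to make the x²
coefficient of Θ' vanish. -/
theorem coeff_of_asymptotics (hr : P.r ≠ 0) (hqd : P.qd ≠ 0) {p q p' q' : ℂ → ℂ} {κ γ : ℂ}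
    (hκ : κ ≠ 0) (hγ : γ ≠ 0) {n : ℕ}
    (hp : Tendsto (fun u => p u / u ^ n) (cobounded ℂ) (𝓝 γ))
    (hp' : Tendsto (fun u => p' u / u ^ n) (cobounded ℂ) (𝓝 0))
    (hq : Tendsto (fun u => u ^ (n + 1) * q u) (cobounded ℂ) (𝓝 (1 / γ)))
    (hq' : Tendsto (fun u => u ^ n * q' u) (cobounded ℂ) (𝓝 (1 / (κ * γ))))
    {N M Θ Θ' : ℂ[X]}
    (h : ∀ᶠ z in cobounded ℂ,
      (2 / κ * N.eval (xOf z)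
        = P.plus z * (p (P.yp z) * q' (P.ym z) - p' (P.yp z) * q (P.ym z))
          + P.minus z * (p (P.ym z) * q' (P.yp z) - p' (P.ym z) * q (P.yp z))) ∧
      (P.dy z * Θ.eval (xOf z)
        = P.plus z * p (P.yp z) * q (P.ym z) - P.minus z * p (P.ym z) * q (P.yp z)) ∧
      (2 * P.dy z / κ * M.eval (xOf z)
        = P.plus z * (p (P.yp z) * q' (P.ym z) + p' (P.yp z) * q (P.ym z))
          + P.minus z * (-(p (P.ym z) * q' (P.yp z)) - p' (P.ym z) * q (P.yp z))))
    (h' : ∀ᶠ z in cobounded ℂ, P.dy z * Θ'.eval (xOf z)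
        = P.plus z * p' (P.yp z) * q' (P.ym z) - P.minus z * p' (P.ym z) * q' (P.yp z)) :
    (N.natDegree ≤ 3 ∧ N.coeff 3 = 4 * P.brc (2 * n)) ∧
    (Θ.natDegree ≤ 1 ∧ Θ.coeff 1 = 8 * (P.brk (2 * n + 1) / P.qd)) ∧
    (M.natDegree ≤ 2 ∧ M.coeff 2 = 4 * (P.brk (2 * n) / P.qd)) ∧
    (Θ'.natDegree ≤ 2 ∧ Θ'.coeff 2 = 0) := by
  have hr' := inv_ne_zero hr
  have hq0 : Tendsto (fun u => u ^ n * q u) (cobounded ℂ) (𝓝 0) := by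
    have := tendsto_inv₀_cobounded.mul hq
    rw [zero_mul] at this
    refine this.congr' ?_
    filter_upwards [eventually_ne_cobounded 0] with u hu
    rw [pow_succ']
    field_simp
  have hdy := P.tendsto_dy
  have hqd2 : P.qd / 2 ≠ 0 := div_ne_zero hqd two_ne_zero
  have dyne : ∀ᶠ z in cobounded ℂ, P.dy z / z ≠ 0 := hdy.eventually_ne hqd2
  have hpl := P.tendsto_plus hqd
  have hmi := P.tendsto_minus hqd
  have E1 : P.brk (2 * n) = P.r ^ (2 * n) * P.sig 6 - (P.r ^ (2 * n))⁻¹ := by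
    exact_mod_cast P.brk_natCast (2 * n)
  have E2 : P.brk (2 * n + 1) = P.r ^ (2 * n + 1) * P.sig 6 - (P.r ^ (2 * n + 1))⁻¹ := by
    exact_mod_cast P.brk_natCast (2 * n + 1)
  have E3 : P.brc (2 * n) = P.r ^ (2 * n) * P.sig 6 + (P.r ^ (2 * n))⁻¹ := by
    exact_mod_cast P.brc_natCast (2 * n)
  have a1 := tendsto_bilinear hpl hr hr' hp hq'
  have a2 := tendsto_bilinear hmi hr' hr hp hq'
  have b1 := tendsto_bilinear hpl hr hr' hp' hq0
  have b2 := tendsto_bilinear hmi hr' hr hp' hq0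
  have c1 := tendsto_bilinear hpl hr hr' hp' hq'
  have c2 := tendsto_bilinear hmi hr' hr hp' hq'
  have d1 := tendsto_bilinear hpl hr hr' hp hq
  have d2 := tendsto_bilinear hmi hr' hr hp hq
  have s1 : γ * (P.r / 2) ^ n * (1 / (κ * γ) * (2 / P.r⁻¹) ^ n) = P.r ^ (2 * n) / κ := by
    rw [div_inv_eq_mul, div_pow, mul_pow, two_mul, pow_add]
    field_simp
  have s2 : γ * (P.r⁻¹ / 2) ^ n * (1 / (κ * γ) * (2 / P.r) ^ n) = (P.r ^ (2 * n))⁻¹ / κ := by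
    rw [div_pow, inv_pow, div_pow, two_mul, pow_add]
    field_simp
  have s3 : γ * (P.r / 2) ^ n * (1 / γ * (2 / P.r⁻¹) ^ (n + 1)) = 2 * P.r ^ (2 * n + 1) := by
    rw [div_inv_eq_mul, div_pow, mul_pow]
    field_simp
    ring
  have s4 : γ * (P.r⁻¹ / 2) ^ n * (1 / γ * (2 / P.r) ^ (n + 1)) = 2 * (P.r ^ (2 * n + 1))⁻¹ := by
    rw [div_pow, inv_pow, div_pow, pow_succ, pow_succ, pow_succ, pow_mul']
    field_simp
  rw [mul_assoc, s1] at a1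
  rw [mul_assoc, s2, one_mul] at a2
  rw [mul_assoc, s3] at d1
  rw [mul_assoc, s4, one_mul] at d2
  simp only [zero_mul, mul_zero] at b1 b2 c1 c2
  refine ⟨?_, ?_, ?_, ?_⟩
  · have ht := (((a1.sub b1).add (a2.sub b2)).const_mul (κ / 2))
    obtain ⟨hd, hc⟩ := coeff_of_tendsto_xOf (g := N) (k := 3) (ht.congr' (by
      filter_upwards [h, eventually_ne_cobounded 0] with z hz hz0
      have e : N.eval (xOf z) = κ / 2 * (2 / κ * N.eval (xOf z)) := by field_simp
      rw [e, hz.1, yp, ym, pow_add]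
      field_simp))
    refine ⟨hd, hc.trans ?_⟩
    rw [E3]
    field_simp
    ring
  · have ht := (d1.sub d2).div hdy hqd2
    obtain ⟨hd, hc⟩ := coeff_of_tendsto_xOf (g := Θ) (k := 1) (ht.congr' (by
      filter_upwards [h, eventually_ne_cobounded 0, dyne] with z hz hz0 hz1
      have hz2 : P.dy z ≠ 0 := by
        intro h0
        simp [h0] at hz1
      have e : Θ.eval (xOf z) = P.dy z * Θ.eval (xOf z) / P.dy z := by field_simp
      rw [e, hz.2.1, yp, ym]
      simp only [Pi.div_apply, pow_add]
      field_simp))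
    refine ⟨hd, hc.trans ?_⟩
    rw [E2]
    field_simp
    ring
  · have ht := (((a1.add b1).sub (a2.add b2)).const_mul (κ / 2)).div hdy hqd2
    obtain ⟨hd, hc⟩ := coeff_of_tendsto_xOf (g := M) (k := 2) (ht.congr' (by
      filter_upwards [h, eventually_ne_cobounded 0, dyne] with z hz hz0 hz1
      have hz2 : P.dy z ≠ 0 := by
        intro h0
        simp [h0] at hz1
      have e : M.eval (xOf z) = κ / 2 * (2 * P.dy z / κ * M.eval (xOf z)) / P.dy z := by
        field_simp
      rw [e, hz.2.2, yp, ym]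
      simp only [Pi.div_apply, pow_add]
      field_simp
      ring))
    refine ⟨hd, hc.trans ?_⟩
    rw [E1]
    field_simp
    ring
  · have ht := (c1.sub c2).div hdy hqd2
    obtain ⟨hd, hc⟩ := coeff_of_tendsto_xOf (g := Θ') (k := 2) (ht.congr' (by
      filter_upwards [h', eventually_ne_cobounded 0, dyne] with z hz hz0 hz1
      have hz2 : P.dy z ≠ 0 := by
        intro h0
        simp [h0] at hz1
      have e : Θ'.eval (xOf z) = P.dy z * Θ'.eval (xOf z) / P.dy z := by field_simp
      rw [e, hz, yp, ym]
      simp only [Pi.div_apply, pow_add]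
      field_simp))
    refine ⟨hd, hc.trans ?_⟩
    simp

theorem eval_W (x : ℂ) : P.W.eval x = 4 * (1 + P.sig 6) * x ^ 3 - 2 * (P.sig 1 + P.sig 5) * x ^ 2
    + (P.sig 2 + P.sig 4 - 3 - 3 * P.sig 6) * x + (P.sig 1 - P.sig 3 + P.sig 5) := by
  simp [W]

theorem qd_mul_eval_V (hqd : P.qd ≠ 0) (x : ℂ) : P.qd * P.V.eval x
    = -4 * (1 - P.sig 6) * x ^ 2 + 2 * (P.sig 1 - P.sig 5) * x
      + (1 - P.sig 2 + P.sig 4 - P.sig 6) := by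
  simp [V]
  field_simp

theorem eval_dySq_eq (x : ℂ) : P.dySq.eval x = P.qd ^ 2 * (x ^ 2 - 1) := by
  simp [dySq]

/-- The coefficient of `x⁵` in the conic identity. -/
theorem coeff_relation (hqd : P.qd ≠ 0) {N M T : ℂ[X]}
    (h : N ^ 2 - P.dySq * M ^ 2 = P.W ^ 2 - P.dySq * P.V ^ 2 - P.dySq * T)
    (hN : N.natDegree ≤ 3) (hM : M.natDegree ≤ 2) (hT : T.natDegree ≤ 2) :
    N.coeff 3 * N.coeff 2 - P.qd ^ 2 * (M.coeff 2 * M.coeff 1)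
      = -16 * (P.sig 1 * P.sig 6 + P.sig 5) := by
  have e : ∀ x : ℂ,
      (N.coeff 0 + N.coeff 1 * x + N.coeff 2 * x ^ 2 + N.coeff 3 * x ^ 3) ^ 2
        - P.qd ^ 2 * (x ^ 2 - 1) * (M.coeff 0 + M.coeff 1 * x + M.coeff 2 * x ^ 2) ^ 2
      = (P.W.eval x) ^ 2 - (x ^ 2 - 1) * (P.qd * P.V.eval x) ^ 2
        - P.qd ^ 2 * (x ^ 2 - 1) * (T.coeff 0 + T.coeff 1 * x + T.coeff 2 * x ^ 2) := by
    intro x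
    have h1 := congrArg (eval x) h
    simp only [eval_sub, eval_mul, eval_pow, eval_dySq_eq] at h1
    rw [eval_eq_sum_range' (show N.natDegree < 4 by omega),
      eval_eq_sum_range' (show M.natDegree < 3 by omega),
      eval_eq_sum_range' (show T.natDegree < 3 by omega)] at h1
    simp only [Finset.sum_range_succ, Finset.sum_range_zero, pow_zero, mul_one, zero_add,
      pow_one] at h1
    linear_combination h1
  simp only [P.qd_mul_eval_V hqd, P.eval_W] at e
  -- The weights 1, -4, 5 at 3, 2, 1 kill the odd powers x and x³ and give 240 times the x⁵
  -- coefficient; the other factor 2 comes from the squares.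
  linear_combination (e 3 - e (-3) - 4 * (e 2 - e (-2)) + 5 * (e 1 - e (-1))) / 480

end Params

/-! ### The previous index and the Casoratian -/

section Recurrence

variable {L : (ℂ → ℂ) → ℂ} {B K : ℝ} {p : ℕ → ℂ[X]} {n : ℕ} {a₀ : ℂ}

theorem recA_ne_zero (hL : IsBoundedFunctional L B K) (hp : IsOrthonormalUpTo L p n)
    (ha₀ : a₀ ≠ 0) : recA p a₀ n ≠ 0 := by
  cases n with
  | zero => exact ha₀
  | succ n =>
    exact div_ne_zero (leadingCoeff_ne_zero.2 (hp.ne_zero hL (by omega)))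
      (leadingCoeff_ne_zero.2 (hp.ne_zero hL le_rfl))

theorem tendsto_prevP (hp : IsOrthonormalUpTo L p n) :
    Tendsto (fun u => (prevP p n).eval u / u ^ n) (cobounded ℂ) (𝓝 0) := by
  cases n with
  | zero => simp [prevP]
  | succ n =>
    have hd := hp.1 n (by omega)
    have := tendsto_eval_div_pow tendsto_id (p n) (N := n + 1) (by omega)
    rwa [coeff_eq_zero_of_natDegree_lt (by omega)] at this

/-- For n ≥ 1 one has a_n γ_n = γ_{n-1}; the convention for q_{-1} makes the same formula hold at n
= 0. -/
theorem tendsto_prevQ (hL : IsBoundedFunctional L B K) (hp : IsOrthonormalUpTo L p n) :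
    Tendsto (fun u => u ^ n * prevQ L p a₀ n u) (cobounded ℂ)
      (𝓝 (1 / (recA p a₀ n * (p n).leadingCoeff))) := by
  cases n with
  | zero => simp [prevQ, recA]
  | succ n =>
    have h0 : (p (n + 1)).leadingCoeff ≠ 0 := leadingCoeff_ne_zero.2 (hp.ne_zero hL le_rfl)
    rw [recA, div_mul_cancel₀ _ h0]
    exact (hp.mono (Nat.le_succ n)).tendsto_secondKind hL

theorem IsBoundedFunctional.exists_secondKind_eq (hL : IsBoundedFunctional L B K) (g : ℂ[X]) :
    ∃ a : ℂ[X], ∀ᶠ u in cobounded ℂ, secondKind L g u = stieltjes L u * g.eval u - a.eval u := by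
  obtain ⟨a, ha⟩ := hL.exists_associated_eq g
  refine ⟨a, ?_⟩
  filter_upwards [tendsto_norm_cobounded_atTop.eventually_gt_atTop B] with u hu
  rw [secondKind, ha u hu]

theorem exists_prevQ_eq (hL : IsBoundedFunctional L B K) (p : ℕ → ℂ[X]) (a₀ : ℂ) (n : ℕ) :
    ∃ a : ℂ[X], ∀ᶠ u in cobounded ℂ,
      prevQ L p a₀ n u = stieltjes L u * (prevP p n).eval u - a.eval u := by
  cases n with
  | zero => exact ⟨C (-(1 / (a₀ * (p 0).leadingCoeff))), by simp [prevQ, prevP]⟩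
  | succ n => exact hL.exists_secondKind_eq (p n)

/-- The Casoratian of the orthogonal polynomials and the functions of the second kind. -/
theorem casoratian (hL : IsBoundedFunctional L B K) (hp : IsOrthonormalUpTo L p n) {a a' : ℂ[X]}
    (ha : ∀ᶠ u in cobounded ℂ,
      secondKind L (p n) u = stieltjes L u * (p n).eval u - a.eval u)
    (ha' : ∀ᶠ u in cobounded ℂ,
      prevQ L p a₀ n u = stieltjes L u * (prevP p n).eval u - a'.eval u) :
    prevP p n * a - p n * a' = C (1 / recA p a₀ n) := by
  have h0 : (p n).leadingCoeff ≠ 0 := leadingCoeff_ne_zero.2 (hp.ne_zero hL le_rfl)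
  -- In p_n q_{n-1} - p_{n-1} q_n the Stieltjes function cancels, leaving a polynomial near
  -- infinity; a finite limit there makes it constant.
  have h1 := (tendsto_eval_div_pow tendsto_id (p n) (hp.1 n le_rfl).le).mul
    (tendsto_prevQ (a₀ := a₀) hL hp)
  have h2 := ((tendsto_prevP hp).mul (hp.tendsto_secondKind hL)).mul tendsto_inv₀_cobounded
  have h3 := h1.sub h2
  have h4 : (p n).coeff n = (p n).leadingCoeff := by rw [leadingCoeff, hp.1 n le_rfl]
  rw [h4, mul_zero, sub_zero,
    show (p n).leadingCoeff * (1 / (recA p a₀ n * (p n).leadingCoeff)) = 1 / recA p a₀ n by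
      field_simp] at h3
  obtain ⟨hd, hc⟩ := natDegree_le_and_coeff_eq_of_tendsto tendsto_id
    (prevP p n * a - p n * a') 0 (h3.congr' (by
      filter_upwards [ha, ha', eventually_ne_cobounded 0] with u h1 h2 hu
      rw [h1, h2, eval_sub, eval_mul, eval_mul, pow_succ]
      simp only [id, pow_zero, div_one]
      field_simp
      ring))
  rw [eq_C_of_natDegree_le_zero hd, hc]

end Recurrence

theorem eventually_cobounded_iff {Q : ℂ → Prop} :
    (∀ᶠ z in cobounded ℂ, Q z) ↔ ∃ R : ℝ, ∀ z : ℂ, R < ‖z‖ → Q z := by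
  rw [← comap_norm_atTop, eventually_comap, eventually_atTop]
  constructor
  · rintro ⟨R, h⟩
    exact ⟨R, fun z hz => h _ hz.le z rfl⟩
  · rintro ⟨R, h⟩
    exact ⟨R + 1, fun b hb z hz => h z (by rw [hz]; linarith)⟩

/-! ### Existence of the spectral coefficients and their explicit form -/

section Spectral

variable {P : Params} {L : (ℂ → ℂ) → ℂ} {B K : ℝ} {p : ℕ → ℂ[X]} {n : ℕ} {a₀ : ℂ} {U : ℂ[X]}

/-- There are spectral coefficients, and `2 W_n - W` agrees with `W` at `x = ± 1`. -/
theorem exists_spectralCoeffs (hr : P.r ≠ 0) (hL : IsBoundedFunctional L B K)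
    (hp : IsOrthonormalUpTo L p n) (ha₀ : a₀ ≠ 0)
    (hU : ∀ᶠ z in cobounded ℂ, P.minus z * stieltjes L (P.yp z) - P.plus z * stieltjes L (P.ym z)
      = P.dy z * U.eval (xOf z)) :
    ∃ G Wn Θn Ωn : ℂ[X], 2 * Wn - P.W = P.W + P.dySq * G ∧
      IsSpectralCoeffs P L p a₀ n Wn Θn Ωn := by
  obtain ⟨a, ha⟩ := hL.exists_secondKind_eq (p n)
  obtain ⟨a', ha'⟩ := exists_prevQ_eq hL p a₀ n
  obtain ⟨Θ, hΘ⟩ := P.exists_theta hU (p n) a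
  obtain ⟨G, M, hGM⟩ := P.exists_coefficients hU (recA_ne_zero hL hp ha₀) (casoratian hL hp ha ha')
  have hW : 2 * (P.W + C (1 / 2) * (P.dySq * G)) - P.W = P.W + P.dySq * G := by
    have : (2 : ℂ[X]) * C (1 / 2) = 1 := by
      rw [← C_ofNat, ← C_mul]
      norm_num
    linear_combination P.dySq * G * this
  refine ⟨G, P.W + C (1 / 2) * (P.dySq * G), Θ, M - P.V, hW, ?_⟩
  refine eventually_cobounded_iff.1 ?_
  filter_upwards [hΘ, hGM, (P.tendsto_yp hr).eventually ha, (P.tendsto_ym hr).eventually ha,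
    (P.tendsto_yp hr).eventually ha', (P.tendsto_ym hr).eventually ha'] with z h1 h2 h3 h4 h5 h6
  rw [h3, h4, h5, h6]
  refine ⟨?_, h1, ?_⟩
  · rw [← h2.1, ← hW]
    simp
  · rw [← h2.2]
    simp

/-- Transfers the form W + Δy² G, known for the constructed coefficients, to any others. -/
theorem IsSpectralCoeffs.two_mul_sub_eq (hκ : recA p a₀ n ≠ 0)
    {Wn Θn Ωn Wn' Θn' Ωn' : ℂ[X]}
    (h : IsSpectralCoeffs P L p a₀ n Wn Θn Ωn) (h' : IsSpectralCoeffs P L p a₀ n Wn' Θn' Ωn') :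
    2 * Wn - P.W = 2 * Wn' - P.W := by
  refine eq_of_eventually_eval_xOf ?_
  filter_upwards [eventually_cobounded_iff.2 h, eventually_cobounded_iff.2 h'] with z h1 h2
  have h3 := h1.1.trans h2.1.symm
  have h4 := mul_left_cancel₀ (div_ne_zero two_ne_zero hκ) h3
  simpa using h4

theorem spectral_conic (hr : P.r ≠ 0) (hqd : P.qd ≠ 0) (hσ : P.sig 6 ≠ 0)
    (hn : P.brk (2 * n) ≠ 0) (hn' : P.brk (2 * n + 1) ≠ 0)
    (hL : IsBoundedFunctional L B K) (hp : IsOrthonormalUpTo L p n) (ha₀ : a₀ ≠ 0)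
    (hU : ∀ᶠ z in cobounded ℂ, P.minus z * stieltjes L (P.yp z) - P.plus z * stieltjes L (P.ym z)
      = P.dy z * U.eval (xOf z)) {Wn Θn Ωn : ℂ[X]}
    (h : IsSpectralCoeffs P L p a₀ n Wn Θn Ωn) :
      ∃ lam : ℂ, (∀ x : ℂ, Θn.eval x = 0 ↔ x = lam) ∧
        ∀ ν μ : ℂ, ν = 2 * Wn.eval lam - P.W.eval lam → μ = Ωn.eval lam + P.V.eval lam →
          ν ^ 2 - P.W.eval lam ^ 2 = P.qd ^ 2 * (lam ^ 2 - 1) * (μ ^ 2 - P.V.eval lam ^ 2) ∧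
          (∀ x : ℂ, Θn.eval x = 8 * (P.brk (2 * n + 1) / P.qd) * (x - lam)) ∧
          (lam ≠ 1 → lam ≠ -1 → ∀ x : ℂ,
            2 * Wn.eval x - P.W.eval x
              = (x ^ 2 - 1) / (lam ^ 2 - 1) * ν
                + (x - lam) * (4 * P.brc (2 * n) * (x ^ 2 - 1)
                  + 1 / 2 * P.W.eval 1 * ((x + 1) / (1 - lam))
                  + 1 / 2 * P.W.eval (-1) * ((x - 1) / (1 + lam))) ∧
            Ωn.eval x + P.V.eval x
              = μ + 4 * (P.brk (2 * n) / P.qd) * x * (x - lam)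
                + 16 / P.qd * (P.sig 6 / P.brk (2 * n))
                  * ((P.sig 1 * P.sig 6 + P.sig 5) / (4 * P.sig 6) - lam) * (x - lam)
                + 1 / P.qd * (P.brc (2 * n) / P.brk (2 * n)) * (x - lam)
                  * (ν / (lam ^ 2 - 1) + 1 / 2 * P.W.eval 1 * (1 / (1 - lam))
                    + 1 / 2 * P.W.eval (-1) * (1 / (1 + lam)))) := by
  have hκ := recA_ne_zero hL hp ha₀
  have hγ : (p n).leadingCoeff ≠ 0 := leadingCoeff_ne_zero.2 (hp.ne_zero hL le_rfl)
  obtain ⟨a, ha⟩ := hL.exists_secondKind_eq (p n)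
  obtain ⟨a', ha'⟩ := exists_prevQ_eq hL p a₀ n
  have hcas := casoratian hL hp ha ha'
  obtain ⟨Θ', hΘ'⟩ := P.exists_theta hU (prevP p n) a'
  obtain ⟨G, Wn', Θn', Ωn', hG, hS⟩ := exists_spectralCoeffs hr hL hp ha₀ hU
  have hNG := (h.two_mul_sub_eq hκ hS).trans hG
  set N : ℂ[X] := 2 * Wn - P.W with hN
  set M : ℂ[X] := Ωn + P.V with hM
  have hNe : ∀ x, 2 * Wn.eval x - P.W.eval x = N.eval x := fun x => by simp [hN]
  have hMe : ∀ x, Ωn.eval x + P.V.eval x = M.eval x := fun x => by simp [hM]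
  have hev := eventually_cobounded_iff.2 h
  simp only [hNe, hMe] at hev ⊢
  have hcas' : ∀ᶠ u in cobounded ℂ, (p n).eval u * prevQ L p a₀ n u
      - (prevP p n).eval u * secondKind L (p n) u = 1 / recA p a₀ n := by
    filter_upwards [ha, ha'] with u h1 h2
    have := congrArg (eval u) hcas
    simp only [eval_sub, eval_mul, eval_C] at this
    rw [h1, h2, ← this]
    ring
  have hΘ'' : ∀ᶠ z in cobounded ℂ, P.dy z * Θ'.eval (xOf z)
      = P.plus z * (prevP p n).eval (P.yp z) * prevQ L p a₀ n (P.ym z)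
        - P.minus z * (prevP p n).eval (P.ym z) * prevQ L p a₀ n (P.yp z) := by
    filter_upwards [hΘ', (P.tendsto_yp hr).eventually ha', (P.tendsto_ym hr).eventually ha']
      with z h1 h2 h3
    rw [h2, h3, h1]
  have hcon := P.conic_identity (p := fun u => (p n).eval u) (p' := fun u => (prevP p n).eval u)
    hκ hcas' hr hev hΘ''
  have hlead := tendsto_eval_div_pow tendsto_id (p n) (hp.1 n le_rfl).le
  rw [show (p n).coeff n = (p n).leadingCoeff by rw [leadingCoeff, hp.1 n le_rfl]] at hlead
  obtain ⟨⟨hN3, hNc⟩, ⟨hT1, hTc⟩, ⟨hM2, hMc⟩, ⟨hT'2, hT'c⟩⟩ :=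
    P.coeff_of_asymptotics hr hqd hκ hγ hlead (tendsto_prevP hp) (hp.tendsto_secondKind hL)
      (tendsto_prevQ hL hp) hev hΘ''
  have hT'1 : Θ'.natDegree ≤ 1 := by
    rw [natDegree_le_iff_coeff_eq_zero]
    intro j hj
    rcases (show 2 ≤ j from hj).eq_or_lt with rfl | hj
    · exact hT'c
    · exact coeff_eq_zero_of_natDegree_lt (by omega)
  -- As Θ_n and Θ' have degree at most 1, the term Δy² Θ_n Θ' has degree at most 4 in x and misses
  -- the x⁵ coefficient.
  have hrel := P.coeff_relation hqd (T := C (recA p a₀ n ^ 2) * (Θn * Θ'))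
    (by rw [hcon]; ring) hN3 hM2
    ((natDegree_C_mul_le _ _).trans ((natDegree_mul_le).trans (by omega)))
  have eN : ∀ x, N.eval x = N.coeff 0 + N.coeff 1 * x + N.coeff 2 * x ^ 2 + N.coeff 3 * x ^ 3 := by
    intro x
    rw [eval_eq_sum_range' (show N.natDegree < 4 by omega)]
    simp [Finset.sum_range_succ]
  have eM : ∀ x, M.eval x = M.coeff 0 + M.coeff 1 * x + M.coeff 2 * x ^ 2 := by
    intro x
    rw [eval_eq_sum_range' (show M.natDegree < 3 by omega)]
    simp [Finset.sum_range_succ]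
  have eΘ : ∀ x, Θn.eval x = Θn.coeff 0 + 8 * (P.brk (2 * n + 1) / P.qd) * x := by
    intro x
    rw [eval_eq_sum_range' (show Θn.natDegree < 2 by omega)]
    simp [Finset.sum_range_succ, hTc]
  have hN1 : P.W.eval 1 = N.eval 1 := by
    rw [hNG, eval_add, eval_mul, P.eval_dySq_eq]
    ring
  have hN1' : P.W.eval (-1) = N.eval (-1) := by
    rw [hNG, eval_add, eval_mul, P.eval_dySq_eq]
    ring
  have hθ : 8 * (P.brk (2 * n + 1) / P.qd) ≠ 0 :=
    mul_ne_zero (by norm_num) (div_ne_zero hn' hqd)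
  set θ := 8 * (P.brk (2 * n + 1) / P.qd)
  obtain ⟨lam, hlam⟩ : ∃ lam, Θn.coeff 0 = -(θ * lam) := ⟨-Θn.coeff 0 / θ, by field_simp⟩
  have eΘ' : ∀ x, Θn.eval x = θ * (x - lam) := by
    intro x
    rw [eΘ, hlam]
    ring
  refine ⟨lam, fun x => ?_, ?_⟩
  · rw [eΘ', mul_eq_zero, or_iff_right hθ, sub_eq_zero]
  rintro ν μ rfl rfl
  refine ⟨?_, eΘ', ?_⟩
  · have h1 := congrArg (eval lam) hcon
    simp only [eval_sub, eval_mul, eval_pow, eval_C, P.eval_dySq_eq, eΘ', sub_self, mul_zero,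
      zero_mul, sub_zero] at h1
    linear_combination h1
  · intro hl1 hl2 x
    have d1 : 1 - lam ≠ 0 := sub_ne_zero.2 (Ne.symm hl1)
    have d2 : 1 + lam ≠ 0 := fun h0 => hl2 (by linear_combination h0)
    have d3 : lam ^ 2 - 1 = -((1 - lam) * (1 + lam)) := by ring
    -- The left side is the second divided difference of the cubic N at 1, -1, λ.
    have key : N.eval lam / (lam ^ 2 - 1) + 1 / 2 * P.W.eval 1 * (1 / (1 - lam))
        + 1 / 2 * P.W.eval (-1) * (1 / (1 + lam)) = N.coeff 2 + N.coeff 3 * lam := by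
      rw [hN1, hN1', d3, eN, eN 1, eN (-1)]
      field_simp
      ring
    constructor
    · rw [← hNc, hN1, hN1', d3, eN, eN 1, eN (-1), eN lam]
      field_simp
      ring
    · rw [key, eM, eM lam, hMc, hNc]
      rw [hMc, hNc] at hrel
      have hb := P.brc_sq_sub_brk_sq hr (2 * n)
      have hM1 : M.coeff 1 = (4 * (P.sig 1 * P.sig 6 + P.sig 5) + P.brc (2 * n) * N.coeff 2)
          / (P.qd * P.brk (2 * n)) := by
        rw [eq_div_iff (mul_ne_zero hqd hn)]
        field_simp at hrel
        linear_combination -hrel / 4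
      rw [hM1]
      field_simp
      -- The λ terms match through {n}² - [n]² = 4σ̃₆.
      linear_combination -16 * lam * (x - lam) * hb

end Spectral

/-! ### From the Pearson equation to the difference equation for the Stieltjes function -/

theorem continuousOn_xOf : ContinuousOn xOf {0}ᶜ := by
  unfold xOf
  exact (continuousOn_id.add (continuousOn_id.inv₀ fun _ h => h)).div_const 2

theorem norm_le_of_norm_xOf_le {z : ℂ} {B : ℝ} (hB : 0 ≤ B) (h : ‖xOf z‖ ≤ B) :
    ‖z‖ ≤ 2 * B + 1 := by
  by_contra! hz
  rw [xOf, norm_div, RCLike.norm_ofNat, div_le_iff₀ two_pos] at h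
  have h1 := norm_sub_norm_le z (-z⁻¹)
  rw [sub_neg_eq_add, norm_neg, norm_inv] at h1
  have h2 : ‖z‖⁻¹ ≤ 1 := inv_le_one_of_one_le₀ (by linarith)
  linarith

theorem xOf_inv (z : ℂ) : xOf z⁻¹ = xOf z := by
  rw [xOf, xOf, inv_inv, add_comm]

/-- `L` vanishes on the image of the Cauchy kernel under the operator adjoint to the
divided-difference operator of the Pearson equation. -/
def IsPearsonFunctional (P : Params) (L : (ℂ → ℂ) → ℂ) (B : ℝ) : Prop :=
  ∀ᶠ X in cobounded ℂ, ∀ φ : ℂ → ℂ, ContinuousOn φ (closedBall 0 B) →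
    (∀ ζ : ℂ, ζ ≠ 0 → xOf ζ ∈ closedBall (0 : ℂ) B →
      P.dy ζ * φ (xOf ζ) = P.minus (P.r⁻¹ * ζ) / (X - P.ym ζ) - P.plus (P.r * ζ) / (X - P.yp ζ)) →
    L φ = 0

theorem IsPearsonFunctional.exists_stieltjes_eq {P : Params} {L : (ℂ → ℂ) → ℂ} {B K : ℝ}
    (hr : P.r ≠ 0) (hqd : P.qd ≠ 0) (hL : IsBoundedFunctional L B K)
    (hP : IsPearsonFunctional P L B) :
    ∃ U : ℂ[X], ∀ᶠ z in cobounded ℂ,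
      P.minus z * stieltjes L (P.yp z) - P.plus z * stieltjes L (P.ym z)
        = P.dy z * U.eval (xOf z) := by
  set e₁ := 8 / P.qd * (P.sig 6 * P.r - P.r⁻¹) with he₁
  set e₂ := 8 / P.qd * (P.sig 6 * P.r ^ 2 - (P.r ^ 2)⁻¹) with he₂
  set e₃ := 4 / P.qd * (P.sig 1 * P.r⁻¹ - P.sig 5 * P.r) with he₃
  set m₀ := L fun _ => 1 with hm₀
  set m₁ := L fun y => y with hm₁
  have hker : ∀ X, ContinuousOn (P.kerG X) (closedBall 0 B) := by
    intro X
    unfold Params.kerG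
    fun_prop
  have hLker : ∀ X, L (P.kerG X) = (e₁ * X + e₃) * m₀ + e₂ * m₁ := by
    intro X
    rw [hm₀, hm₁, ← hL.smul _ (fun _ => 1) continuousOn_const,
      ← hL.smul _ (fun y => y) continuousOn_id,
      ← hL.add (fun _ => (e₁ * X + e₃) * 1) (fun y => e₂ * y) (by fun_prop) (by fun_prop)]
    congr 1
    ext y
    rw [Params.kerG]
    ring
  -- U is minus `L` applied to the affine remainder `kerG`, expressed through the moments of order 0
  -- and 1.
  refine ⟨-(C (e₁ * m₀) * X + C (e₃ * m₀ + e₂ * m₁)), ?_⟩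
  have hdy : ∀ᶠ z in cobounded ℂ, P.dy z / z ≠ 0 :=
    P.tendsto_dy.eventually_ne (div_ne_zero hqd two_ne_zero)
  filter_upwards [eventually_ne_cobounded 0, hdy, tendsto_xOf.eventually hP,
    (P.tendsto_yp hr).eventually (tendsto_norm_cobounded_atTop.eventually_gt_atTop B),
    (P.tendsto_ym hr).eventually (tendsto_norm_cobounded_atTop.eventually_gt_atTop B)]
    with z hz hdz hPz hyp hym
  have hdz : P.dy z ≠ 0 := fun h0 => by simp [h0] at hdz
  have c1 : ContinuousOn (fun y : ℂ => 1 / (P.yp z - y)) (closedBall 0 B) := by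
    simpa using continuousOn_eval_div_sub hyp 1
  have c2 : ContinuousOn (fun y : ℂ => 1 / (P.ym z - y)) (closedBall 0 B) := by
    simpa using continuousOn_eval_div_sub hym 1
  have c3 : ContinuousOn (fun y : ℂ => P.minus z / P.dy z * (1 / (P.yp z - y))) (closedBall 0 B) :=
    continuousOn_const.mul c1
  have c4 : ContinuousOn (fun y : ℂ => -P.plus z / P.dy z * (1 / (P.ym z - y))) (closedBall 0 B) :=
    continuousOn_const.mul c2
  -- This side of the kernel identity is continuous on the disc, so it extends the quotient by Δy(ζ)
  -- across ζ = ±1, where Δy vanishes.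
  have h0 := hPz (fun y => P.minus z / P.dy z * (1 / (P.yp z - y))
    + -P.plus z / P.dy z * (1 / (P.ym z - y)) + P.kerG (xOf z) y) ((c3.add c4).add (hker _)) (by
      intro ζ hζ hx
      have h1 := P.kernel_identity hr hqd hz hζ
      have h2 := P.node_symm hr hz hζ
      have n1 := sub_ne_zero_of_mem_closedBall hyp hx
      have n2 := sub_ne_zero_of_mem_closedBall hym hx
      have n3 : (xOf z - P.yp ζ) * (xOf z - P.ym ζ) ≠ 0 := by
        rw [h2, show (xOf ζ - P.yp z) * (xOf ζ - P.ym z) = (P.yp z - xOf ζ) * (P.ym z - xOf ζ) by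
          ring]
        exact mul_ne_zero n1 n2
      have n4 := left_ne_zero_of_mul n3
      have n5 := right_ne_zero_of_mul n3
      have h3 : P.minus (P.r⁻¹ * ζ) / (xOf z - P.ym ζ) - P.plus (P.r * ζ) / (xOf z - P.yp ζ)
          = (P.minus (P.r⁻¹ * ζ) * (xOf z - P.yp ζ) - P.plus (P.r * ζ) * (xOf z - P.ym ζ))
            / ((P.yp z - xOf ζ) * (P.ym z - xOf ζ)) := by
        rw [show (P.yp z - xOf ζ) * (P.ym z - xOf ζ) = (xOf z - P.yp ζ) * (xOf z - P.ym ζ) by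
          rw [h2]; ring]
        field_simp
      rw [h3]
      generalize P.minus (P.r⁻¹ * ζ) = s at h1 ⊢
      generalize P.plus (P.r * ζ) = t at h1 ⊢
      field_simp
      linear_combination h1)
  rw [hL.add (fun y => P.minus z / P.dy z * (1 / (P.yp z - y))
    + -P.plus z / P.dy z * (1 / (P.ym z - y))) _ (c3.add c4) (hker _), hL.add _ _ c3 c4, hL.smul _ _ c1, hL.smul _ _ c2,
    hLker] at h0
  rw [stieltjes, stieltjes]
  simp only [eval_neg, eval_add, eval_mul, eval_C, eval_X]
  field_simp at h0
  linear_combination h0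

/-! ### Weights on a lattice -/

theorem tsum_sub_succ_eq_zero {g : ℤ → ℂ} (hg : Tendsto g cofinite (𝓝 0))
    (hs : Summable fun s => g s - g (s + 1)) : ∑' s, (g s - g (s + 1)) = 0 := by
  have h1 : Tendsto (fun N : ℕ => Finset.Ico (-(N : ℤ)) N) atTop atTop := Finset.tendsto_Ico_neg
  have h2 : ∀ N : ℕ, ∑ s ∈ Finset.Ico (-(N : ℤ)) N, (g s - g (s + 1)) = g (-N) - g N := by
    intro N
    induction N with
    | zero => simp
    | succ N ih =>
      have e : Finset.Ico (-((N + 1 : ℕ) : ℤ)) ((N + 1 : ℕ) : ℤ)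
          = insert (-(N : ℤ) - 1) (insert (N : ℤ) (Finset.Ico (-(N : ℤ)) N)) := by
        ext s
        simp only [Finset.mem_insert, Finset.mem_Ico]
        omega
      rw [e, Finset.sum_insert (by simp), Finset.sum_insert (by simp), ih]
      push_cast
      rw [show -(N : ℤ) - 1 + 1 = -N by ring, show -((N : ℤ) + 1) = -N - 1 by ring]
      ring
  have h3 := hs.hasSum.comp h1
  have h4 : Tendsto (fun N : ℕ => g (-N) - g N) atTop (𝓝 (0 - 0)) := by
    refine Tendsto.sub ?_ ?_
    · refine hg.comp (Nat.cofinite_eq_atTop ▸ Function.Injective.tendsto_cofinite ?_)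
      intro a b hab
      simpa using hab
    · exact hg.comp (Nat.cofinite_eq_atTop ▸ Function.Injective.tendsto_cofinite Nat.cast_injective)
  rw [sub_zero] at h4
  exact tendsto_nhds_unique h3 (h4.congr fun N => (h2 N).symm)

namespace IsLatticeSemiClassical

variable {P : Params} {z₀ : ℂ} {w : ℤ → ℂ}

theorem isBoundedFunctional (h : IsLatticeSemiClassical P z₀ w) {B : ℝ}
    (hB : ∀ s : ℤ, w s ≠ 0 → ‖xOf (z₀ * P.r ^ (2 * s))‖ ≤ B) :
    IsBoundedFunctional ((Weight.lattice z₀ w).integral P) B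
      (∑' s : ℤ, ‖P.dy (z₀ * P.r ^ (2 * s)) * w s‖) := by
  have hb : ∀ (φ : ℂ → ℂ) (M : ℝ), (∀ y ∈ closedBall (0 : ℂ) B, ‖φ y‖ ≤ M) → ∀ s : ℤ,
      ‖P.dy (z₀ * P.r ^ (2 * s)) * w s * φ (xOf (z₀ * P.r ^ (2 * s)))‖
        ≤ ‖P.dy (z₀ * P.r ^ (2 * s)) * w s‖ * M := by
    intro φ M hM s
    by_cases hs : w s = 0
    · simp [hs]
    · rw [norm_mul _ (φ _)]
      gcongr
      exact hM _ (mem_closedBall_zero_iff.2 (hB s hs))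
  have hsum : ∀ φ : ℂ → ℂ, ContinuousOn φ (closedBall 0 B) →
      Summable fun s : ℤ => P.dy (z₀ * P.r ^ (2 * s)) * w s * φ (xOf (z₀ * P.r ^ (2 * s))) := by
    intro φ hφ
    obtain ⟨M, hM⟩ := (isCompact_closedBall (0 : ℂ) B).exists_bound_of_continuousOn hφ
    exact Summable.of_norm_bounded (h.summable.norm.mul_right M) (hb φ M hM)
  refine ⟨fun φ ψ hφ hψ => ?_, fun c φ hφ => ?_, fun φ M hφ hM => ?_⟩
  · simp only [Weight.integral, mul_add]
    exact (hsum φ hφ).tsum_add (hsum ψ hψ)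
  · simp only [Weight.integral]
    rw [← tsum_mul_left]
    congr 1
    ext s
    ring
  · simp only [Weight.integral]
    rw [← tsum_mul_right]
    exact tsum_of_norm_bounded (h.summable.norm.mul_right M).hasSum (hb φ M hM)

/-- The upper node of x_s is the lower node of x_{s+1}, so the Pearson equation turns the summand
into g(s) - g(s+1), and g tends to 0 at both ends. -/
theorem isPearsonFunctional (h : IsLatticeSemiClassical P z₀ w) (hr : P.r ≠ 0) {B : ℝ}
    (hB0 : 0 ≤ B) (hB : ∀ s : ℤ, w s ≠ 0 → ‖xOf (z₀ * P.r ^ (2 * s))‖ ≤ B) :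
    IsPearsonFunctional P ((Weight.lattice z₀ w).integral P) B := by
  -- A compact annulus away from 0 containing every lattice parameter with nonzero weight; the
  -- factor multiplying w in g is bounded there, so g inherits the decay of w.
  set A : Set ℂ := closedBall 0 (2 * B + 1) ∩ {ζ | (2 * B + 1)⁻¹ ≤ ‖ζ‖} with hA
  have hC : 0 < 2 * B + 1 := by linarith
  have hA0 : A ⊆ {0}ᶜ := by
    rintro ζ ⟨-, hζ⟩ rfl
    have h0 : (2 * B + 1)⁻¹ ≤ ‖(0 : ℂ)‖ := hζ
    rw [norm_zero] at h0
    exact absurd (inv_pos.2 hC) h0.not_gt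
  have hAc : IsCompact A :=
    (isCompact_closedBall _ _).inter_right (isClosed_le continuous_const continuous_norm)
  have hcm : ContinuousOn (fun ζ => P.r⁻¹ * ζ) A := by fun_prop
  have hmaps : Set.MapsTo (fun ζ => P.r⁻¹ * ζ) A {0}ᶜ :=
    fun ζ hζ => mul_ne_zero (inv_ne_zero hr) (hA0 hζ)
  have hym : ContinuousOn P.ym A := continuousOn_xOf.comp hcm hmaps
  have hdyc : ContinuousOn P.dy {0}ᶜ := by
    have : ContinuousOn (fun z : ℂ => P.qd * (z - z⁻¹) / 2) {0}ᶜ :=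
      (continuousOn_const.mul (continuousOn_id.sub
        (continuousOn_id.inv₀ fun _ h => h))).div_const 2
    exact this.congr fun z _ => P.dy_eq z
  have hminus : ContinuousOn P.minus {0}ᶜ :=
    (P.W.continuous.comp_continuousOn continuousOn_xOf).sub
      (hdyc.mul (P.V.continuous.comp_continuousOn continuousOn_xOf))
  obtain ⟨R, hR⟩ := hAc.exists_bound_of_continuousOn hym
  filter_upwards [tendsto_norm_cobounded_atTop.eventually_gt_atTop R] with X hX φ hφ hD
  have hψ : ContinuousOn (fun ζ => P.minus (P.r⁻¹ * ζ) / (X - P.ym ζ)) A := by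
    refine (hminus.comp hcm hmaps).div (continuousOn_const.sub hym) fun ζ hζ h0 => ?_
    have := hR ζ hζ
    rw [← sub_eq_zero.1 h0] at this
    exact absurd hX this.not_gt
  obtain ⟨M, hM⟩ := hAc.exists_bound_of_continuousOn hψ
  have hne : ∀ s : ℤ, z₀ * P.r ^ (2 * s) ≠ 0 := fun s => mul_ne_zero h.ne_zero (zpow_ne_zero _ hr)
  have hmem : ∀ s : ℤ, w s ≠ 0 → z₀ * P.r ^ (2 * s) ∈ A := by
    intro s hs
    refine ⟨mem_closedBall_zero_iff.2 (norm_le_of_norm_xOf_le hB0 (hB s hs)), ?_⟩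
    have h1 := norm_le_of_norm_xOf_le hB0 ((xOf_inv _).symm ▸ hB s hs)
    rw [norm_inv] at h1
    exact inv_le_of_inv_le₀ (norm_pos_iff.2 (hne s)) h1
  set g : ℤ → ℂ := fun s => w s * (P.minus (P.r⁻¹ * (z₀ * P.r ^ (2 * s)))
    / (X - P.ym (z₀ * P.r ^ (2 * s)))) with hg
  have hg0 : Tendsto g cofinite (𝓝 0) := by
    have h1 := h.terminating.norm.mul_const M
    rw [norm_zero, zero_mul] at h1
    refine squeeze_zero_norm (fun s => ?_) h1
    by_cases hs : w s = 0
    · simp [hg, hs]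
    · rw [hg, norm_mul]
      gcongr
      exact hM _ (hmem s hs)
  have hterm : ∀ s : ℤ, P.dy (z₀ * P.r ^ (2 * s)) * w s * φ (xOf (z₀ * P.r ^ (2 * s)))
      = g s - g (s + 1) := by
    intro s
    have e1 : P.r⁻¹ * (z₀ * P.r ^ (2 * (s + 1))) = z₀ * P.r ^ (2 * s + 1) := by
      rw [show 2 * (s + 1) = 2 * s + 1 + 1 by ring, zpow_add_one₀ hr (2 * s + 1)]
      field_simp
    have e2 : P.r * (z₀ * P.r ^ (2 * s)) = z₀ * P.r ^ (2 * s + 1) := by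
      rw [zpow_add_one₀ hr]
      ring
    have e3 : P.ym (z₀ * P.r ^ (2 * (s + 1))) = P.yp (z₀ * P.r ^ (2 * s)) := by
      rw [Params.ym, Params.yp, e1, e2]
    have e4 : g (s + 1) = w s * (P.plus (P.r * (z₀ * P.r ^ (2 * s)))
        / (X - P.yp (z₀ * P.r ^ (2 * s)))) := by
      simp only [hg]
      rw [e3, e1, e2]
      linear_combination h.pearson s / (X - P.yp (z₀ * P.r ^ (2 * s)))
    rw [e4]
    -- Off the support x_s may lie outside the disc, where nothing is known about φ, but both sides
    -- vanish; for g(s+1) this uses its Pearson form `e4`.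
    by_cases hs : w s = 0
    · simp [hg, hs]
    · have := hD _ (hne s) (mem_closedBall_zero_iff.2 (hB s hs))
      simp only [hg]
      linear_combination w s * this
  have hsum : Summable fun s : ℤ => g s - g (s + 1) := by
    simp only [← hterm]
    obtain ⟨M, hM⟩ := (isCompact_closedBall (0 : ℂ) B).exists_bound_of_continuousOn hφ
    refine Summable.of_norm_bounded (h.summable.norm.mul_right M) fun s => ?_
    by_cases hs : w s = 0
    · simp [hs]
    · rw [norm_mul _ (φ _)]
      gcongr
      exact hM _ (mem_closedBall_zero_iff.2 (hB s hs))
  simp only [Weight.integral, hterm]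
  exact tsum_sub_succ_eq_zero hg0 hsum

end IsLatticeSemiClassical

/-! ### Weights on the interval -/

theorem xOf_exp (θ : ℝ) : xOf (Complex.exp (θ * Complex.I)) = (Real.cos θ : ℂ) := by
  rw [xOf, ← Complex.exp_neg, Complex.ofReal_cos, Complex.cos, neg_mul]

theorem Params.dy_exp (P : Params) (θ : ℝ) :
    P.dy (Complex.exp (θ * Complex.I)) = P.qd * Complex.I * (Real.sin θ : ℂ) := by
  rw [P.dy_eq, ← Complex.exp_neg, Complex.ofReal_sin, Complex.sin, neg_mul]
  linear_combination P.qd * (Complex.exp (θ * Complex.I) - Complex.exp (-(θ * Complex.I))) / 2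
    * Complex.I_mul_I

theorem exp_neg_mul_I (θ : ℝ) :
    Complex.exp (((-θ : ℝ) : ℂ) * Complex.I) = (Complex.exp (θ * Complex.I))⁻¹ := by
  rw [← Complex.exp_neg, Complex.ofReal_neg, neg_mul]

/-- The argument of c only shifts θ, which periodicity absorbs; this permits complex q^{1/2}. -/
theorem integral_comp_mul_exp (g : ℂ → ℂ) (c : ℂ) :
    ∫ θ in (-Real.pi)..Real.pi, g (c * Complex.exp (θ * Complex.I))
      = ∫ θ in (0 : ℝ)..2 * Real.pi, g (circleMap 0 ‖c‖ θ) := by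
  have h1 : ∀ θ : ℝ, c * Complex.exp (θ * Complex.I) = circleMap 0 ‖c‖ (θ + c.arg) := by
    intro θ
    rw [circleMap, zero_add, Complex.ofReal_add, add_mul, Complex.exp_add, mul_comm (Complex.exp _),
      ← mul_assoc, Complex.norm_mul_exp_arg_mul_I]
  have h2 : Function.Periodic (fun θ => g (circleMap 0 ‖c‖ θ)) (2 * Real.pi) := fun θ => by
    simp only [periodic_circleMap 0 ‖c‖ θ]
  simp only [h1]
  rw [intervalIntegral.integral_comp_add_right (fun θ => g (circleMap 0 ‖c‖ θ)),
    show Real.pi + c.arg = -Real.pi + c.arg + 2 * Real.pi by ring,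
    h2.intervalIntegral_add_eq _ 0, zero_add]

theorem circleIntegral_inv_mul (g : ℂ → ℂ) {R : ℝ} (hR : R ≠ 0) :
    (∮ z in C(0, R), (z - 0)⁻¹ • g z)
      = Complex.I * ∫ θ in (0 : ℝ)..2 * Real.pi, g (circleMap 0 R θ) := by
  rw [circleIntegral, ← intervalIntegral.integral_const_mul]
  congr 1
  ext θ
  have : circleMap 0 R θ ≠ 0 := circleMap_ne_center hR
  rw [deriv_circleMap, smul_eq_mul, smul_eq_mul, sub_zero]
  field_simp

/-- The mean values over the bounding circles of an annulus agree. -/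
theorem integral_circle_eq_of_annulus {g : ℂ → ℂ} {R : ℝ} (hR : 0 < R)
    (hc : ContinuousOn g {z | min 1 R ≤ ‖z‖ ∧ ‖z‖ ≤ max 1 R})
    (hd : DifferentiableOn ℂ g {z | min 1 R < ‖z‖ ∧ ‖z‖ < max 1 R}) :
    ∫ θ in (0 : ℝ)..2 * Real.pi, g (circleMap 0 1 θ)
      = ∫ θ in (0 : ℝ)..2 * Real.pi, g (circleMap 0 R θ) := by
  have hopen : IsOpen {z : ℂ | min 1 R < ‖z‖ ∧ ‖z‖ < max 1 R} :=
    (isOpen_lt continuous_const continuous_norm).inter (isOpen_lt continuous_norm continuous_const)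
  have h := Complex.circleIntegral_sub_center_inv_smul_eq_of_differentiable_on_annulus_off_countable
    (c := 0) (r := min 1 R) (R := max 1 R) (lt_min one_pos hR) (min_le_max) Set.countable_empty
    (f := g)
    (hc.mono fun z hz => ⟨not_lt.1 fun h0 => hz.2 (mem_ball_zero_iff.2 h0),
      mem_closedBall_zero_iff.1 hz.1⟩)
    (fun z hz => hd.differentiableAt (hopen.mem_nhds
      ⟨not_le.1 fun h0 => hz.1.2 (mem_closedBall_zero_iff.2 h0), mem_ball_zero_iff.1 hz.1.1⟩))
  rw [circleIntegral_inv_mul _ (lt_max_of_lt_left one_pos).ne',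
    circleIntegral_inv_mul _ (lt_min one_pos hR).ne'] at h
  have h' := mul_left_cancel₀ Complex.I_ne_zero h
  rcases le_total 1 R with h1 | h1
  · rw [max_eq_right h1, min_eq_left h1] at h'
    exact h'.symm
  · rwa [max_eq_left h1, min_eq_right h1] at h'

theorem ae_mul_exp_notMem {E : Set ℂ} (hE : E.Countable) {c : ℂ} (hc : c ≠ 0) :
    ∀ᵐ θ : ℝ, c * Complex.exp (θ * Complex.I) ∉ E := by
  have h1 : ((fun u => c * u) ⁻¹' E).Countable :=
    hE.preimage (mul_right_injective₀ hc)
  have h2 := h1.preimage_circleMap 0 one_ne_zero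
  filter_upwards [h2.ae_notMem MeasureTheory.volume] with θ hθ
  simpa [circleMap] using hθ

namespace IsIntervalSemiClassical

variable {P : Params} {w : ℂ → ℂ}

theorem isBoundedFunctional (h : IsIntervalSemiClassical P w) :
    IsBoundedFunctional ((Weight.interval w).integral P) 1
      (∫ θ in (0 : ℝ)..Real.pi, ‖w (Complex.exp (θ * Complex.I)) * (Real.sin θ : ℂ)‖) := by
  have hmem : ∀ θ : ℝ, (Real.cos θ : ℂ) ∈ closedBall (0 : ℂ) 1 := by
    intro θ
    rw [mem_closedBall_zero_iff, Complex.norm_real]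
    exact Real.abs_cos_le_one θ
  have hint : ∀ φ : ℂ → ℂ, ContinuousOn φ (closedBall 0 1) → IntervalIntegrable
      (fun θ : ℝ => w (Complex.exp (θ * Complex.I)) * φ (Real.cos θ : ℂ) * (Real.sin θ : ℂ))
      MeasureTheory.volume 0 Real.pi := by
    intro φ hφ
    have h1 : Continuous fun θ : ℝ => φ (Real.cos θ : ℂ) :=
      hφ.comp_continuous (by fun_prop) hmem
    refine (h.integrable.mul_continuousOn h1.continuousOn).congr ?_
    exact fun θ _ => by ring
  refine ⟨fun φ ψ hφ hψ => ?_, fun c φ hφ => ?_, fun φ M hφ hM => ?_⟩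
  · simp only [Weight.integral]
    rw [← intervalIntegral.integral_add (hint φ hφ) (hint ψ hψ)]
    congr 1
    ext θ
    ring
  · simp only [Weight.integral]
    rw [← intervalIntegral.integral_const_mul]
    congr 1
    ext θ
    ring
  · simp only [Weight.integral]
    rw [← intervalIntegral.integral_mul_const]
    refine intervalIntegral.norm_integral_le_of_norm_le Real.pi_pos.le ?_
      (h.integrable.norm.mul_const M)
    refine Eventually.of_forall fun θ _ => ?_
    rw [mul_right_comm, norm_mul]
    gcongr
    exact hM _ (hmem θ)

/-- The inversion z ↦ z⁻¹ unfolds the two kernel terms over (0, π) into a single integral over the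
unit circle. On the circle of radius |r|⁻¹ the integrand is odd in θ, so the integral vanishes. -/
theorem isPearsonFunctional (h : IsIntervalSemiClassical P w) (hr : P.r ≠ 0) (hqd : P.qd ≠ 0) :
    IsPearsonFunctional P ((Weight.interval w).integral P) 1 := by
  obtain ⟨H, hHc, hHd, hfin⟩ := h.continuation
  set A : Set ℂ := {z | min 1 ‖P.r‖⁻¹ ≤ ‖z‖ ∧ ‖z‖ ≤ max 1 ‖P.r‖⁻¹} with hA
  set A' : Set ℂ := {z | min 1 ‖P.r‖⁻¹ < ‖z‖ ∧ ‖z‖ < max 1 ‖P.r‖⁻¹} with hA'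
  set E : Set ℂ := {z | (min 1 ‖P.r‖⁻¹ ≤ ‖z‖ ∧ ‖z‖ ≤ max 1 ‖P.r‖⁻¹) ∧ H z ≠ P.plus (P.r * z) * w z}
    with hE
  have hρ : 0 < ‖P.r‖⁻¹ := inv_pos.2 (norm_pos_iff.2 hr)
  have hsub : A' ⊆ A := fun z hz => ⟨hz.1.le, hz.2.le⟩
  have hA0 : ∀ z ∈ A, z ≠ 0 := by
    rintro z hz rfl
    have := hz.1
    rw [norm_zero] at this
    exact absurd (lt_min one_pos hρ) this.not_gt
  have hAc : IsCompact A := by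
    have : A = closedBall 0 (max 1 ‖P.r‖⁻¹) ∩ {z | min 1 ‖P.r‖⁻¹ ≤ ‖z‖} := by
      ext z
      simp [hA, and_comm]
    rw [this]
    exact (isCompact_closedBall _ _).inter_right (isClosed_le continuous_const continuous_norm)
  have hypd : ∀ z ∈ A, DifferentiableAt ℂ P.yp z := by
    intro z hz
    have h0 : P.r * z ≠ 0 := mul_ne_zero hr (hA0 z hz)
    have : DifferentiableAt ℂ (fun z => (P.r * z + (P.r * z)⁻¹) / 2) z := by
      fun_prop (disch := assumption)
    exact this
  have hypc : ContinuousOn P.yp A := fun z hz => (hypd z hz).continuousAt.continuousWithinAt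
  obtain ⟨R, hR⟩ := hAc.exists_bound_of_continuousOn hypc
  filter_upwards [tendsto_norm_cobounded_atTop.eventually_gt_atTop R] with X hX φ hφ hD
  have hne : ∀ z ∈ A, X - P.yp z ≠ 0 := by
    intro z hz h0
    have := hR z hz
    rw [← sub_eq_zero.1 h0] at this
    exact absurd hX this.not_gt
  have hA1 : ∀ θ : ℝ, Complex.exp (θ * Complex.I) ∈ A := by
    intro θ
    simp [hA, Complex.norm_exp_ofReal_mul_I]
  have hA2 : ∀ θ : ℝ, P.r⁻¹ * Complex.exp (θ * Complex.I) ∈ A := by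
    intro θ
    simp [hA, Complex.norm_exp_ofReal_mul_I]
  set g : ℂ → ℂ := fun z => H z / (X - P.yp z) with hg
  have hgc : ContinuousOn g A := hHc.div (continuousOn_const.sub hypc) hne
  have hgd : DifferentiableOn ℂ g A' :=
    hHd.div (fun z hz => ((differentiableAt_const X).sub
      (hypd z (hsub hz))).differentiableWithinAt) fun z hz => hne z (hsub hz)
  -- the Cauchy theorem moves the contour to the circle where the Pearson equation applies
  have hmove : ∫ θ in (-Real.pi)..Real.pi, g (Complex.exp (θ * Complex.I))
      = ∫ θ in (-Real.pi)..Real.pi, g (P.r⁻¹ * Complex.exp (θ * Complex.I)) := by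
    have e1 := integral_comp_mul_exp g 1
    simp only [one_mul, norm_one] at e1
    rw [e1, integral_comp_mul_exp g P.r⁻¹, norm_inv, integral_circle_eq_of_annulus hρ hgc hgd]
  set k : ℝ → ℂ := fun θ => P.plus (Complex.exp (θ * Complex.I))
    * w (P.r⁻¹ * Complex.exp (θ * Complex.I)) / (X - xOf (Complex.exp (θ * Complex.I))) with hk
  have hk1 : ∫ θ in (-Real.pi)..Real.pi, g (P.r⁻¹ * Complex.exp (θ * Complex.I))
      = ∫ θ in (-Real.pi)..Real.pi, k θ := by
    refine intervalIntegral.integral_congr_ae ?_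
    filter_upwards [ae_mul_exp_notMem hfin.countable (inv_ne_zero hr)] with θ hθ _
    have : H (P.r⁻¹ * Complex.exp (θ * Complex.I)) = P.plus (P.r * (P.r⁻¹ *
        Complex.exp (θ * Complex.I))) * w (P.r⁻¹ * Complex.exp (θ * Complex.I)) := by
      by_contra h0
      exact hθ ⟨hA2 θ, h0⟩
    simp only [hg, hk]
    rw [this, Params.yp, mul_inv_cancel_left₀ hr]
  -- Inversion exchanges W ± Δy V and replaces w(r⁻¹u) by -w(ru); the Pearson equation restores the
  -- original term up to sign.
  have hkodd : ∀ θ, k (-θ) = -k θ := by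
    intro θ
    have hu : Complex.exp (θ * Complex.I) ≠ 0 := Complex.exp_ne_zero _
    have hpe := h.pearson (Complex.exp (θ * Complex.I)) (Complex.norm_exp_ofReal_mul_I θ)
    simp only [hk]
    rw [exp_neg_mul_I, P.plus_inv hqd hu, xOf_inv, ← mul_inv, h.odd, mul_neg, hpe, neg_div]
  have hk0 : ∫ θ in (-Real.pi)..Real.pi, k θ = 0 := by
    have h1 := intervalIntegral.integral_comp_neg (a := -Real.pi) (b := Real.pi) k
    simp only [hkodd, neg_neg, intervalIntegral.integral_neg] at h1
    have h2 : (2 : ℂ) * ∫ θ in (-Real.pi)..Real.pi, k θ = 0 := by linear_combination -h1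
    simpa using h2
  set m : ℝ → ℂ := fun θ => P.plus (P.r * Complex.exp (θ * Complex.I))
    * w (Complex.exp (θ * Complex.I)) / (X - P.yp (Complex.exp (θ * Complex.I))) with hm
  have hmae : ∀ᵐ θ : ℝ, g (Complex.exp (θ * Complex.I)) = m θ := by
    filter_upwards [ae_mul_exp_notMem hfin.countable one_ne_zero] with θ hθ
    rw [one_mul] at hθ
    have : H (Complex.exp (θ * Complex.I)) = P.plus (P.r *
        Complex.exp (θ * Complex.I)) * w (Complex.exp (θ * Complex.I)) := by
      by_contra h0
      exact hθ ⟨hA1 θ, h0⟩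
    simp only [hg, hm]
    rw [this]
  have hm0 : ∫ θ in (-Real.pi)..Real.pi, m θ = 0 := by
    rw [← hk0, ← hk1, ← hmove]
    refine intervalIntegral.integral_congr_ae ?_
    filter_upwards [hmae] with θ hθ _ using hθ.symm
  have hgcont : Continuous fun θ : ℝ => g (Complex.exp (θ * Complex.I)) :=
    hgc.comp_continuous (by fun_prop) hA1
  -- Integrability comes from the continuous representative g, so no estimate on w is needed.
  have hmint : ∀ a b : ℝ, IntervalIntegrable m MeasureTheory.volume a b := by
    intro a b
    exact (hgcont.intervalIntegrable a b).congr_ae (MeasureTheory.ae_restrict_of_ae hmae)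
  have hmneg : ∫ θ in (-Real.pi)..0, m θ = ∫ θ in (0 : ℝ)..Real.pi, m (-θ) := by
    rw [intervalIntegral.integral_comp_neg m, neg_zero]
  have hmint' : IntervalIntegrable (fun θ => m (-θ)) MeasureTheory.volume 0 Real.pi := by
    have := (IntervalIntegrable.iff_comp_neg (by simp)).1 (hmint 0 (-Real.pi))
    rwa [neg_zero, neg_neg] at this
  rw [← intervalIntegral.integral_add_adjacent_intervals (hmint (-Real.pi) 0) (hmint 0 Real.pi),
    hmneg, ← intervalIntegral.integral_add hmint' (hmint 0 Real.pi)] at hm0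
  -- The terms at θ and -θ are the y₊ and y₋ parts of the kernel; the factor `qd` i sin θ is Δy on
  -- the unit circle.
  have hfinal : ∀ θ : ℝ, m (-θ) + m θ = -(P.qd * Complex.I) *
      (w (Complex.exp (θ * Complex.I)) * φ (Real.cos θ : ℂ) * (Real.sin θ : ℂ)) := by
    intro θ
    have hu : Complex.exp (θ * Complex.I) ≠ 0 := Complex.exp_ne_zero _
    have hmem : xOf (Complex.exp (θ * Complex.I)) ∈ closedBall (0 : ℂ) 1 := by
      rw [xOf_exp, mem_closedBall_zero_iff, Complex.norm_real]
      exact Real.abs_cos_le_one θ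
    have hDθ := hD _ hu hmem
    rw [P.dy_exp, xOf_exp] at hDθ
    have e1 : P.r * (Complex.exp (θ * Complex.I))⁻¹ = (P.r⁻¹ * Complex.exp (θ * Complex.I))⁻¹ := by
      rw [mul_inv, inv_inv]
    have e2 : P.yp (Complex.exp (θ * Complex.I))⁻¹ = P.ym (Complex.exp (θ * Complex.I)) := by
      rw [Params.yp, e1, xOf_inv, Params.ym]
    simp only [hm]
    rw [exp_neg_mul_I, e2, e1, P.plus_inv hqd (mul_ne_zero (inv_ne_zero hr) hu), h.odd]
    linear_combination w (Complex.exp (θ * Complex.I)) * hDθ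
  simp only [hfinal, intervalIntegral.integral_const_mul] at hm0
  exact (mul_eq_zero.1 hm0).resolve_left (neg_ne_zero.2 (mul_ne_zero hqd Complex.I_ne_zero))

end IsIntervalSemiClassical

theorem Weight.IsSemiClassical.exists_functional {P : Params} (hr : P.r ≠ 0) (hqd : P.qd ≠ 0)
    {w : Weight} (hw : w.IsSemiClassical P) :
    ∃ B K : ℝ, IsBoundedFunctional (w.integral P) B K ∧ IsPearsonFunctional P (w.integral P) B := by
  cases w with
  | lattice z₀ w =>
    have hw : IsLatticeSemiClassical P z₀ w := hw
    obtain ⟨B, hB⟩ := hw.bounded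
    have hB' : ∀ s : ℤ, w s ≠ 0 → ‖xOf (z₀ * P.r ^ (2 * s))‖ ≤ max B 0 :=
      fun s hs => (hB s hs).trans (le_max_left _ _)
    exact ⟨_, _, hw.isBoundedFunctional hB', hw.isPearsonFunctional hr (le_max_right _ _) hB'⟩
  | interval w =>
    have hw : IsIntervalSemiClassical P w := hw
    exact ⟨_, _, hw.isBoundedFunctional, hw.isPearsonFunctional hr hqd⟩

end DeformedAW

end

theorem mainTheorem8 (P : DeformedAW.Params)
    (hr : P.r ≠ 0) (hq : P.r ^ 2 ≠ 1) (ha : ∀ j, P.a j ≠ 0) (hα : P.α ≠ 0) (ht : P.t ≠ 0)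
    (w : DeformedAW.Weight) (hw : w.IsSemiClassical P)
    (n : ℕ) (hn : P.brk (2 * n) ≠ 0) (hn' : P.brk (2 * n + 1) ≠ 0)
    (p : ℕ → Polynomial ℂ) (hp : DeformedAW.IsOrthonormalUpTo (w.integral P) p n)
    (a₀ : ℂ) (ha₀ : a₀ ≠ 0) :
    (∃ Wn Θn Ωn : Polynomial ℂ,
      DeformedAW.IsSpectralCoeffs P (w.integral P) p a₀ n Wn Θn Ωn) ∧
    ∀ Wn Θn Ωn : Polynomial ℂ,
      DeformedAW.IsSpectralCoeffs P (w.integral P) p a₀ n Wn Θn Ωn →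
      ∃ lam : ℂ, (∀ x : ℂ, Θn.eval x = 0 ↔ x = lam) ∧
        ∀ ν μ : ℂ, ν = 2 * Wn.eval lam - P.W.eval lam → μ = Ωn.eval lam + P.V.eval lam →
          ν ^ 2 - P.W.eval lam ^ 2 = P.qd ^ 2 * (lam ^ 2 - 1) * (μ ^ 2 - P.V.eval lam ^ 2) ∧
          (∀ x : ℂ, Θn.eval x = 8 * (P.brk (2 * n + 1) / P.qd) * (x - lam)) ∧
          (lam ≠ 1 → lam ≠ -1 → ∀ x : ℂ,
            2 * Wn.eval x - P.W.eval x
              = (x ^ 2 - 1) / (lam ^ 2 - 1) * ν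
                + (x - lam) * (4 * P.brc (2 * n) * (x ^ 2 - 1)
                  + 1 / 2 * P.W.eval 1 * ((x + 1) / (1 - lam))
                  + 1 / 2 * P.W.eval (-1) * ((x - 1) / (1 + lam))) ∧
            Ωn.eval x + P.V.eval x
              = μ + 4 * (P.brk (2 * n) / P.qd) * x * (x - lam)
                + 16 / P.qd * (P.sig 6 / P.brk (2 * n))
                  * ((P.sig 1 * P.sig 6 + P.sig 5) / (4 * P.sig 6) - lam) * (x - lam)
                + 1 / P.qd * (P.brc (2 * n) / P.brk (2 * n)) * (x - lam)
                  * (ν / (lam ^ 2 - 1) + 1 / 2 * P.W.eval 1 * (1 / (1 - lam))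
                    + 1 / 2 * P.W.eval (-1) * (1 / (1 + lam)))) := by
  have hqd := P.qd_ne_zero hr hq
  obtain ⟨B, K, hL, hP⟩ := hw.exists_functional hr hqd
  obtain ⟨U, hU⟩ := hP.exists_stieltjes_eq hr hqd hL
  obtain ⟨-, Wn, Θn, Ωn, -, hS⟩ := DeformedAW.exists_spectralCoeffs hr hL hp ha₀ hU
  exact ⟨⟨Wn, Θn, Ωn, hS⟩, fun Wn Θn Ωn h =>
    DeformedAW.spectral_conic hr hqd (P.sig_six_ne_zero hr ha hα ht) hn hn' hL hp ha₀ hU h⟩
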